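/- Let $h : M \to S$ be a continuous mapping from a metric space $M$ to a locally compact separable metric space $S$, both with their Borel $\sigma$-algebras. A (time-homogeneous) Markov family on $M$ consists of processes $X^x_t$, $t \ge 0$, $x \in M$, with values in $M$ such that $X^x_0 = x$ almost surely, $p(t,x,B) = \mathrm{P}(X^x_t \in B)$ is measurable in $x$ for all $t \ge 0$ and Borel $B$, and $\mathrm{P}(X^x_{s+t} \in B \mid \sigma(X^x_u, u \le s)) = p(t, X^x_s, B)$ almost surely for all $s,t \ge 0$, $x \in M$ and Borel $B$. For each $\varepsilon > 0$, let $X^{x,\varepsilon}_t$, $x \in M$, be a Markov family on $M$, and suppose that the processes $Y^{x,\varepsilon}_t = h(X^{x,\varepsilon}_t)$, $x \in M$, $\varepsilon > 0$, have continuous trajectories. Let $Y^y_t$, $y \in S$, be a Markov family on $S$ with continuous trajectories whose semigroup $(T_t f)(y) = \mathrm{E} f(Y^y_t)$, $t \ge 0$, preserves the space $C_0(S)$ of real continuous functions vanishing at infinity, with the supremum norm. Let $A : \mathcal{D}(A) \to C_0(S)$ be the infinitesimal generator of this family, i.e. $Af = \lim_{t \downarrow 0} (T_t f - f)/t$ in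 $C_0(S)$, with $\mathcal{D}(A)$ the set of all $f \in C_0(S)$ for which this limit exists. Let $\Psi$ be a dense linear subspace of $C_0(S)$ and $\mathcal{D}$ a linear subspace of $\mathcal{D}(A)$ such that: (1) There is $\lambda > 0$ such that for each $f \in \Psi$ the equation $\lambda F - AF = f$ has a solution $F \in \mathcal{D}$. (2) For each $T > 0$, each $f \in \mathcal{D}$, and each compact $K \subseteq S$, $$\lim_{\varepsilon \downarrow 0} \mathrm{E}\left( f(Y^{x,\varepsilon}_T) - f(Y^{x,\varepsilon}_0) - \int_0^T Af(Y^{x,\varepsilon}_t)\,dt \right) = 0, \quad \text{uniformly in } x \in h^{-1}(K).$$ Suppose also that, for each $x \in M$, the family of measures on $C([0,\infty), S)$ (with the topology of uniform convergence on compact sets) induced by the processes $Y^{x,\varepsilon}_t$, $\varepsilon > 0$, is tight. Then, for each $x \in M$, the measures on $C([0,\infty), S)$ induced by the processes $Y^{x,\varepsilon}_t$ converge weakly, as $\varepsilon \downarrow 0$, to the measure induced by the process $Y^{h(x)}_t$. -/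

import Mathlib

open MeasureTheory ProbabilityTheory Filter Topology
open scoped NNReal ENNReal ZeroAtInfty

noncomputable section

/-- The σ-algebra generated by `X u`, `u ≤ s`. -/
abbrev processPast {Ω M : Type*} [MeasurableSpace M] (X : ℝ≥0 → Ω → M) (s : ℝ≥0) :
    MeasurableSpace Ω :=
  ⨆ u : Set.Iic s, MeasurableSpace.comap (X u) inferInstance

/-- A (time-homogeneous, conservative) Markov family on `M`: for every starting point `x`, a process
`X x t`, `t ≥ 0`, on a probability space `(Ω x, P x)`. The Markov property is with respect to the
filtration generated by the process. -/
structure MarkovFamily (M : Type*) [MeasurableSpace M] where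
  Ω : M → Type*
  mΩ : ∀ x, MeasurableSpace (Ω x)
  P : ∀ x, Measure (Ω x)
  isProb : ∀ x, IsProbabilityMeasure (P x)
  X : ∀ x, ℝ≥0 → Ω x → M
  measurable_X : ∀ x t, Measurable (X x t)
  /-- the transition probabilities depend measurably on the starting point -/
  measurable_trans : ∀ (t : ℝ≥0) (B : Set M), MeasurableSet B →
    Measurable fun x => P x (X x t ⁻¹' B)
  start : ∀ x, ∀ᵐ ω ∂P x, X x 0 ω = x
  markov : ∀ (x : M) (s t : ℝ≥0) (B : Set M), MeasurableSet B →
    (P x)[(X x (s + t) ⁻¹' B).indicator (fun _ => (1 : ℝ)) | processPast (X x) s]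
      =ᵐ[P x] fun ω => (P (X x s ω)).real (X (X x s ω) t ⁻¹' B)

attribute [instance] MarkovFamily.mΩ MarkovFamily.isProb

/-- The path space `C([0, ∞), S)`, with the topology of uniform convergence on compact
sets (the compact-open topology), carries its Borel σ-algebra. -/
instance pathMeasurableSpace {S : Type*} [TopologicalSpace S] : MeasurableSpace C(ℝ≥0, S) :=
  borel _

instance pathBorelSpace {S : Type*} [TopologicalSpace S] : BorelSpace C(ℝ≥0, S) := ⟨rfl⟩

section PathLaw

variable {S : Type*} [MetricSpace S] [TopologicalSpace.SeparableSpace S]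
  [MeasurableSpace S] [BorelSpace S] {Ω : Type*} [MeasurableSpace Ω]

theorem measurable_path (Z : ℝ≥0 → Ω → S) (hm : ∀ t, Measurable (Z t))
    (hc : ∀ ω, Continuous fun t => Z t ω) :
    Measurable (fun ω => (⟨fun t => Z t ω, hc ω⟩ : C(ℝ≥0, S))) := by
  have : SecondCountableTopology S := UniformSpace.secondCountable_of_separable S
  have hb : (pathMeasurableSpace : MeasurableSpace C(ℝ≥0, S)) = _ :=
    borel_eq_generateFrom_of_subbasis (ContinuousMap.compactOpen_eq (X := ℝ≥0) (Y := S))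
  rw [hb]
  refine measurable_generateFrom ?_
  rintro _ ⟨K, hK, U, hU, rfl⟩
  obtain ⟨c, hcK, hcc, hKc⟩ :=
    (TopologicalSpace.IsSeparable.of_separableSpace K).exists_countable_dense_subset
  have key : ((fun ω => (⟨fun t => Z t ω, hc ω⟩ : C(ℝ≥0, S))) ⁻¹' {f | Set.MapsTo f K U}) =
      ⋃ n : ℕ, ⋂ t ∈ c, {ω | ((n : ℝ≥0∞))⁻¹ ≤ Metric.infEDist (Z t ω) Uᶜ} := by
    ext ω
    have hcont : Continuous fun t => Metric.infEDist (Z t ω) Uᶜ :=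
      Metric.continuous_infEDist.comp (hc ω)
    have hpos : ∀ t, 0 < Metric.infEDist (Z t ω) Uᶜ ↔ Z t ω ∈ U := fun t => by
      rw [Metric.infEDist_pos_iff_notMem_closure, hU.isClosed_compl.closure_eq, Set.notMem_compl_iff]
    simp only [Set.mem_preimage, Set.mem_ofPred_eq, Set.mem_iUnion, Set.mem_iInter]
    constructor
    · intro hmaps
      rcases K.eq_empty_or_nonempty with hKe | hKne
      · exact ⟨0, fun t ht => by simpa [hKe] using hcK ht⟩
      · obtain ⟨t₀, ht₀, hmin⟩ := hK.exists_isMinOn hKne hcont.continuousOn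
        obtain ⟨n, hn⟩ := ENNReal.exists_inv_nat_lt ((hpos t₀).2 (hmaps ht₀)).ne'
        exact ⟨n, fun t ht => hn.le.trans (hmin (hcK ht))⟩
    · rintro ⟨n, hn⟩ t ht
      have hcl : closure c ⊆ {t | ((n : ℝ≥0∞))⁻¹ ≤ Metric.infEDist (Z t ω) Uᶜ} :=
        closure_minimal hn (isClosed_le continuous_const hcont)
      exact (hpos t).1 (lt_of_lt_of_le (by simp) (hcl (hKc ht)))
  rw [key]
  exact MeasurableSet.iUnion fun n => MeasurableSet.biInter hcc fun t _ =>
    measurableSet_le measurable_const (Metric.continuous_infEDist.measurable.comp (hm t))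

/-- The measure induced on `C([0, ∞), S)` by a process with continuous trajectories. -/
def pathLaw (P : Measure Ω) [IsProbabilityMeasure P] (Z : ℝ≥0 → Ω → S)
    (hm : ∀ t, Measurable (Z t)) (hc : ∀ ω, Continuous fun t => Z t ω) :
    ProbabilityMeasure C(ℝ≥0, S) :=
  ⟨P.map fun ω => (⟨fun t => Z t ω, hc ω⟩ : C(ℝ≥0, S)),
    Measure.isProbabilityMeasure_map (measurable_path Z hm hc).aemeasurable⟩

end PathLaw

/-- The infinitesimal generator of a one-parameter family `T` of linear operators on a Banach
space: `A f` is the norm limit of `(T t f - f) / t` as `t ↓ 0`, and the domain is the set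
of those `f` for which the limit exists. -/
def infinitesimalGenerator {E : Type*} [NormedAddCommGroup E] [NormedSpace ℝ E]
    (T : ℝ≥0 → E →ₗ[ℝ] E) : E →ₗ.[ℝ] E where
  domain :=
    { carrier := {f | ∃ g, Tendsto (fun t : ℝ≥0 => (t : ℝ)⁻¹ • (T t f - f)) (𝓝[>] 0) (𝓝 g)}
      zero_mem' := ⟨0, by simp⟩
      add_mem' := by
        rintro f₁ f₂ ⟨g₁, h₁⟩ ⟨g₂, h₂⟩
        refine ⟨g₁ + g₂, (h₁.add h₂).congr fun t => ?_⟩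
        rw [map_add, ← smul_add]
        congr 1
        abel
      smul_mem' := by
        rintro c f ⟨g, h⟩
        refine ⟨c • g, (h.const_smul c).congr fun t => ?_⟩
        rw [map_smul, ← smul_sub, smul_comm] }
  toFun :=
    { toFun := fun f => f.2.choose
      map_add' := by
        rintro f₁ f₂
        refine tendsto_nhds_unique (f₁ + f₂).2.choose_spec
          ((f₁.2.choose_spec.add f₂.2.choose_spec).congr fun t => ?_)
        rw [Submodule.coe_add, map_add, ← smul_add]
        congr 1
        abel
      map_smul' := by
        rintro c f
        refine tendsto_nhds_unique (c • f).2.choose_spec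
          ((f.2.choose_spec.const_smul c).congr fun t => ?_)
        rw [Submodule.coe_smul, map_smul, ← smul_sub, smul_comm] }

namespace MarkovFamily

variable {S : Type*} [MetricSpace S] [MeasurableSpace S] [BorelSpace S]

/-- The transition semigroup maps `C₀(S)` into itself: `y ↦ E f(Y^y_t)` is in `C₀(S)`
whenever `f` is. -/
def PreservesC0 (Y : MarkovFamily S) : Prop :=
  ∀ (t : ℝ≥0) (f : C₀(S, ℝ)), ∃ g : C₀(S, ℝ), ∀ y, g y = ∫ ω, f (Y.X y t ω) ∂(Y.P y)

theorem integrable_comp (Y : MarkovFamily S) (f : C₀(S, ℝ)) (t : ℝ≥0) (y : S) :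
    Integrable (fun ω => f (Y.X y t ω)) (Y.P y) :=
  Integrable.of_bound
    ((f.continuous.measurable.comp (Y.measurable_X y t)).aestronglyMeasurable) ‖f‖
    (Eventually.of_forall fun ω => by
      have := f.toBCF.norm_coe_le_norm (Y.X y t ω)
      simpa using this)

/-- The transition semigroup `(T t f) y = E f(Y^y_t)` on `C₀(S)`. -/
def semigroup (Y : MarkovFamily S) (hY : Y.PreservesC0) (t : ℝ≥0) : C₀(S, ℝ) →ₗ[ℝ] C₀(S, ℝ) where
  toFun f := (hY t f).choose
  map_add' f g := by
    ext y
    rw [ZeroAtInftyContinuousMap.add_apply, (hY t f).choose_spec, (hY t g).choose_spec,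
      (hY t (f + g)).choose_spec,
      ← integral_add (Y.integrable_comp f t y) (Y.integrable_comp g t y)]
    rfl
  map_smul' c f := by
    ext y
    rw [RingHom.id_apply, ZeroAtInftyContinuousMap.smul_apply, (hY t f).choose_spec,
      (hY t (c • f)).choose_spec, ← integral_smul]
    rfl

theorem semigroup_apply (Y : MarkovFamily S) (hY : Y.PreservesC0) (t : ℝ≥0) (f : C₀(S, ℝ))
    (y : S) : Y.semigroup hY t f y = ∫ ω, f (Y.X y t ω) ∂(Y.P y) :=
  (hY t f).choose_spec y

/-- The infinitesimal generator of the Markov family, as an unbounded operator on `C₀(S)`. -/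
def generator (Y : MarkovFamily S) (hY : Y.PreservesC0) : C₀(S, ℝ) →ₗ.[ℝ] C₀(S, ℝ) :=
  infinitesimalGenerator (Y.semigroup hY)

end MarkovFamily

end

/-!
By tightness it suffices to show that every limit point `μ` of the laws of `h ∘ X^{x,ε}` is the law
of `Y^{h(x)}`. By the Markov property, the conditional expectation given the past of the increment
over `[s, s + T]` of `F (w t) - ∫₀ᵗ (A F) (w r) dr` is the expectation in hypothesis (2), evaluated
at the random point `X^{x,ε}_s`. Tightness confines `h (X^{x,ε}_s)` to a compact set up to a small
probability, so this conditional expectation tends to `0` in mean. Hence `μ`, like the law of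
`Y^{h(x)}`, solves the martingale problem for `A` restricted to `𝒟`.

Such solutions are unique. For a test function `Φ` of the past of `s`, the weighted marginals
`m t : f ↦ ∫ Φ(w) f(w t) dμ(w)` satisfy `m (s + T) F - m s F = ∫₀ᵀ m (s + t) (A F) dt`. The
difference of the weighted marginals of two solutions that agree at time `s` therefore has a Laplace
transform vanishing on the range of `λ - A`. As `A` is dissipative, this range is dense for every
positive `λ` once it is for one, so the Laplace transform and with it the difference vanish.
Inserting the times one by one gives equality of all finite-dimensional distributions.
-/

theorem integral_eval_mul_eq_zero_of_moments_eq_zero {a b : ℝ} {k : ℝ → ℝ}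
    (hk : ContinuousOn k (Set.uIcc a b)) (hmoment : ∀ n : ℕ, ∫ x in a..b, x ^ n * k x = 0)
    (p : Polynomial ℝ) : ∫ x in a..b, p.eval x * k x = 0 := by
  simp_rw [Polynomial.eval_eq_sum_range, Finset.sum_mul, mul_assoc]
  rw [intervalIntegral.integral_finsetSum fun i _ =>
    ((continuous_pow i).continuousOn.fun_mul hk).intervalIntegrable.const_mul _]
  exact Finset.sum_eq_zero fun i _ => by
    rw [intervalIntegral.integral_const_mul, hmoment, mul_zero]

theorem eqOn_zero_of_moments_eq_zero {a b : ℝ} (hab : a < b) {k : ℝ → ℝ}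
    (hk : ContinuousOn k (Set.Icc a b)) (hmoment : ∀ n : ℕ, ∫ x in a..b, x ^ n * k x = 0) :
    Set.EqOn k 0 (Set.Icc a b) := by
  have hk' : ContinuousOn k (Set.uIcc a b) := by rwa [Set.uIcc_of_le hab.le]
  have hint : IntervalIntegrable k volume a b := hk'.intervalIntegrable
  have happrox : ∀ δ > 0, ∫ x in a..b, k x * k x ≤ δ * ∫ x in a..b, |k x| := by
    intro δ hδ
    obtain ⟨p, hp⟩ := exists_polynomial_near_of_continuousOn a b k hk δ hδ
    calc ∫ x in a..b, k x * k x = ∫ x in a..b, (k x * k x - p.eval x * k x) := by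
          rw [intervalIntegral.integral_sub (hk'.fun_mul hk').intervalIntegrable
            (p.continuous.continuousOn.fun_mul hk').intervalIntegrable,
            integral_eval_mul_eq_zero_of_moments_eq_zero hk' hmoment, sub_zero]
      _ ≤ ∫ x in a..b, δ * |k x| := by
          refine intervalIntegral.integral_mono_on hab.le ((hk'.fun_mul hk').fun_sub
            (p.continuous.continuousOn.fun_mul hk')).intervalIntegrable (hint.abs.const_mul δ)
            fun x hx => ?_
          rw [← sub_mul]
          refine (le_abs_self _).trans ?_
          rw [abs_mul, abs_sub_comm]
          gcongr
          exact (hp x hx).le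
      _ = δ * ∫ x in a..b, |k x| := intervalIntegral.integral_const_mul _ _
  have hsq_nonpos : ∫ x in a..b, k x * k x ≤ 0 := by
    refine le_of_forall_pos_le_add fun η hη => ?_
    obtain ⟨δ, hδ, hδη⟩ := exists_pos_mul_lt hη (∫ x in a..b, |k x|)
    linarith [happrox δ hδ, mul_comm δ (∫ x in a..b, |k x|)]
  by_contra hne
  obtain ⟨x, hx, hkx⟩ : ∃ x ∈ Set.Icc a b, k x ≠ 0 := by
    simpa only [Set.EqOn, Pi.zero_apply, not_forall, exists_prop] using hne
  exact hsq_nonpos.not_gt (intervalIntegral.integral_pos hab (hk.fun_mul hk)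
    (fun _ _ => mul_self_nonneg _) ⟨x, hx, mul_self_pos.2 hkx⟩)

theorem image_exp_neg_Ioi_zero : (fun t : ℝ => Real.exp (-t)) '' Set.Ioi 0 = Set.Ioo 0 1 := by
  ext x
  constructor
  · rintro ⟨t, ht, rfl⟩
    exact ⟨Real.exp_pos _, Real.exp_lt_one_iff.2 (neg_neg_of_pos ht)⟩
  · rintro ⟨hx0, hx1⟩
    exact ⟨-Real.log x, neg_pos.2 (Real.log_neg hx0 hx1), by simp [Real.exp_log hx0]⟩

theorem intervalIntegral_zero_one_eq_integral_exp_neg (g : ℝ → ℝ) :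
    ∫ x in (0 : ℝ)..1, g x = ∫ t in Set.Ioi (0 : ℝ), Real.exp (-t) * g (Real.exp (-t)) := by
  have hderiv : ∀ t ∈ Set.Ioi (0 : ℝ),
      HasDerivWithinAt (fun t => Real.exp (-t)) (-Real.exp (-t)) (Set.Ioi 0) t := fun t _ => by
    simpa using ((hasDerivAt_neg t).exp).hasDerivWithinAt
  have hinj : Set.InjOn (fun t : ℝ => Real.exp (-t)) (Set.Ioi 0) :=
    (Real.exp_injective.comp neg_injective).injOn
  rw [intervalIntegral.integral_of_le zero_le_one, integral_Ioc_eq_integral_Ioo,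
    ← image_exp_neg_Ioi_zero,
    integral_image_eq_integral_abs_deriv_smul measurableSet_Ioi hderiv hinj]
  simp only [abs_neg, Real.abs_exp, smul_eq_mul]

theorem continuous_mul_comp_neg_log {u : ℝ → ℝ} (hu : Continuous u) {C : ℝ}
    (hC : ∀ t, |u t| ≤ C) : Continuous fun x => x * u (-Real.log x) := by
  refine continuous_iff_continuousAt.2 fun x => ?_
  rcases eq_or_ne x 0 with rfl | hx
  · have hbound : Tendsto (fun x : ℝ => |x| * C) (𝓝 0) (𝓝 0) := by
      simpa using (continuous_abs.fun_mul continuous_const).tendsto' (0 : ℝ) (|0| * C) rfl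
    have hzero : Tendsto (fun x => x * u (-Real.log x)) (𝓝 0) (𝓝 0) :=
      squeeze_zero_norm (fun x => by rw [norm_mul, Real.norm_eq_abs]; gcongr; exact hC _) hbound
    simpa [ContinuousAt] using hzero
  · exact continuousAt_id.mul (hu.continuousAt.comp (Real.continuousAt_log hx).neg)

theorem eq_zero_of_laplace_eq_zero {u : ℝ → ℝ} (hu : Continuous u) {C : ℝ}
    (hC : ∀ t, |u t| ≤ C)
    (hlaplace : ∀ a : ℝ, 0 < a → ∫ t in Set.Ioi (0 : ℝ), Real.exp (-a * t) * u t = 0)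
    {t : ℝ} (ht : 0 ≤ t) : u t = 0 := by
  have hmoment : ∀ n : ℕ, ∫ x in (0 : ℝ)..1, x ^ n * (x * u (-Real.log x)) = 0 := fun n => by
    rw [intervalIntegral_zero_one_eq_integral_exp_neg]
    refine Eq.trans ?_ (hlaplace (n + 2) (by positivity))
    refine setIntegral_congr_fun measurableSet_Ioi fun t _ => ?_
    simp only [Real.log_exp, neg_neg, ← Real.exp_nat_mul, ← mul_assoc, ← Real.exp_add]
    ring_nf
  have := eqOn_zero_of_moments_eq_zero zero_lt_one
    (continuous_mul_comp_neg_log hu hC).continuousOn hmoment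
    ⟨(Real.exp_pos (-t)).le, Real.exp_le_one_iff.2 (neg_nonpos.2 ht)⟩
  simpa using this

section Dissipative

variable {E : Type*} [NormedAddCommGroup E] [NormedSpace ℝ E]

theorem dense_of_forall_strongDual_eq_zero (W : Submodule ℝ E)
    (hW : ∀ J : StrongDual ℝ E, (∀ w ∈ W, J w = 0) → J = 0) : Dense (W : Set E) := by
  intro x
  rw [← W.topologicalClosure_coe]
  by_contra hx
  have hclosed : IsClosed (W.topologicalClosure : Set E) := W.isClosed_topologicalClosure
  obtain ⟨g, hg⟩ := SeparatingDual.exists_ne_zero (R := ℝ)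
    (x := W.topologicalClosure.mkQ x) (by simpa [← SetLike.mem_coe] using hx)
  refine hg ?_
  have := hW (g ∘L W.topologicalClosure.mkQL) fun w hw => by
    have : W.topologicalClosure.mkQ w = 0 := by simpa using W.le_topologicalClosure hw
    simpa using congrArg g this
  simpa using DFunLike.congr_fun this x

/-- A partially defined operator `A` is dissipative if `m ‖F‖ ≤ ‖m F - A F‖` for all `m > 0`; this
is the only trace of the maximum principle needed for uniqueness. -/
def IsDissipative (A : E →ₗ.[ℝ] E) : Prop :=
  ∀ m : ℝ, 0 < m → ∀ F : A.domain, m * ‖(F : E)‖ ≤ ‖m • (F : E) - A F‖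

namespace IsDissipative

variable {A B : E →ₗ.[ℝ] E}

theorem mono (hB : IsDissipative B) (hAB : A ≤ B) : IsDissipative A := fun m hm F => by
  have := hB m hm (Submodule.inclusion hAB.1 F)
  rwa [← hAB.2 (x := F) (y := Submodule.inclusion hAB.1 F) rfl] at this

theorem denseRange_smul_sub_of_lt (hA : IsDissipative A) {l m : ℝ} (hl : 0 < l)
    (hdense : DenseRange fun F : A.domain => l • (F : E) - A F) (hm : 0 < m) (hml : m < 2 * l) :
    DenseRange fun F : A.domain => m • (F : E) - A F := by
  have hq : |l - m| / l < 1 := by rw [div_lt_one hl, abs_lt]; constructor <;> linarith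
  refine dense_of_forall_strongDual_eq_zero (m • A.domain.subtype - A.toFun).range fun J hJ => ?_
  -- `J` kills `m F - A F`, so `J (l F - A F) = (l - m) J F`, and dissipativity bounds `F`.
  have hbound : ∀ f, ‖J f‖ ≤ (|l - m| / l * ‖J‖) * ‖f‖ := by
    refine fun f => hdense.induction_on (p := fun f => ‖J f‖ ≤ (|l - m| / l * ‖J‖) * ‖f‖) f
      (isClosed_le (by fun_prop) (by fun_prop)) fun F => ?_
    have hJF : J (m • (F : E) - A F) = 0 := hJ _ ⟨F, rfl⟩
    calc ‖J (l • (F : E) - A F)‖ = |l - m| * ‖J F‖ := by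
          rw [← Real.norm_eq_abs, ← norm_mul, ← sub_zero (J _), ← hJF]
          simp only [map_sub, map_smul, smul_eq_mul]
          ring_nf
      _ ≤ |l - m| * (‖J‖ * ‖(F : E)‖) := by gcongr; exact J.le_opNorm _
      _ = |l - m| / l * ‖J‖ * (l * ‖(F : E)‖) := by field_simp
      _ ≤ |l - m| / l * ‖J‖ * ‖l • (F : E) - A F‖ := by gcongr; exact hA l hl F
  have hle : ‖J‖ ≤ |l - m| / l * ‖J‖ := J.opNorm_le_bound (by positivity) hbound
  exact norm_le_zero_iff.1 (by nlinarith [norm_nonneg J])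

theorem denseRange_smul_sub (hA : IsDissipative A) {l m : ℝ} (hl : 0 < l)
    (hdense : DenseRange fun F : A.domain => l • (F : E) - A F) (hm : 0 < m) :
    DenseRange fun F : A.domain => m • (F : E) - A F := by
  have hpow : ∀ n : ℕ, DenseRange fun F : A.domain => ((3 / 2) ^ n * l) • (F : E) - A F := by
    intro n
    induction n with
    | zero => simpa using hdense
    | succ n ih =>
      have hpos : 0 < (3 / 2) ^ n * l := by positivity
      exact hA.denseRange_smul_sub_of_lt hpos ih (by positivity) (by rw [pow_succ]; linarith)
  obtain ⟨n, hn⟩ := pow_unbounded_of_one_lt (m / l) (by norm_num : (1 : ℝ) < 3 / 2)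
  have hmn : m < (3 / 2) ^ n * l := (div_lt_iff₀ hl).1 hn
  exact hA.denseRange_smul_sub_of_lt (hm.trans hmn) (hpow n) hm (by linarith)

end IsDissipative

theorem integrableOn_exp_neg_mul_of_bounded {u : ℝ → ℝ} (hu : Continuous u) {C : ℝ}
    (hC : ∀ t, ‖u t‖ ≤ C) {a : ℝ} (ha : 0 < a) :
    IntegrableOn (fun t => Real.exp (-a * t) * u t) (Set.Ioi 0) :=
  Integrable.mul_bdd (c := C) (exp_neg_integrableOn_Ioi 0 ha) hu.aestronglyMeasurable
    (Eventually.of_forall hC)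

/-- The Laplace transform `∫₀^∞ e^{-at} N t dt` of a bounded, weakly continuous curve `N` of
functionals, again as a functional; its vanishing for all `a > 0` is how one shows `N = 0`. -/
noncomputable def laplaceFunctional (N : ℝ → StrongDual ℝ E) {C : ℝ} (hC : ∀ t, ‖N t‖ ≤ C)
    (hN : ∀ f, Continuous fun t => N t f) {a : ℝ} (ha : 0 < a) : StrongDual ℝ E :=
  have hint f := integrableOn_exp_neg_mul_of_bounded (hN f)
    (fun t => (N t).le_of_opNorm_le (hC t) f) ha
  LinearMap.mkContinuous
    { toFun := fun f => ∫ t in Set.Ioi (0 : ℝ), Real.exp (-a * t) * N t f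
      map_add' := fun f g => by
        simp_rw [map_add, mul_add]
        exact integral_add (hint f) (hint g)
      map_smul' := fun c f => by
        simp_rw [map_smul, smul_eq_mul, mul_left_comm _ c]
        exact integral_const_mul _ _ }
    ((∫ t in Set.Ioi (0 : ℝ), Real.exp (-a * t)) * C) fun f => by
      rw [mul_assoc, ← integral_mul_const]
      refine norm_integral_le_of_norm_le ((exp_neg_integrableOn_Ioi 0 ha).mul_const _)
        (Eventually.of_forall fun t => ?_)
      rw [norm_mul, Real.norm_of_nonneg (Real.exp_pos _).le]
      gcongr
      exact (N t).le_of_opNorm_le (hC t) f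

theorem laplaceFunctional_apply (N : ℝ → StrongDual ℝ E) {C : ℝ} (hC : ∀ t, ‖N t‖ ≤ C)
    (hN : ∀ f, Continuous fun t => N t f) {a : ℝ} (ha : 0 < a) (f : E) :
    laplaceFunctional N hC hN ha f = ∫ t in Set.Ioi (0 : ℝ), Real.exp (-a * t) * N t f := rfl

theorem laplaceFunctional_smul_sub_eq_zero {N : ℝ → StrongDual ℝ E} {C : ℝ} (hC : ∀ t, ‖N t‖ ≤ C)
    (hN : ∀ f, Continuous fun t => N t f) {a : ℝ} (ha : 0 < a) {F G : E}
    (hFG : ∀ T : ℝ, 0 ≤ T → N T F = ∫ t in (0 : ℝ)..T, N t G) :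
    laplaceFunctional N hC hN ha (a • F - G) = 0 := by
  have hderiv : ∀ x ∈ Set.Ioi (0 : ℝ), HasDerivAt (fun t => -(Real.exp (-a * t) * N t F))
      (Real.exp (-a * x) * N x (a • F - G)) x := by
    intro x hx
    have hNF : HasDerivAt (fun t => N t F) (N x G) x := by
      refine ((hN G).integral_hasStrictDerivAt 0 x).hasDerivAt.congr_of_eventuallyEq ?_
      filter_upwards [Ioi_mem_nhds hx] with t ht using hFG t (le_of_lt ht)
    have hexp : HasDerivAt (fun t => Real.exp (-a * t)) (Real.exp (-a * x) * (-a)) x := by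
      simpa using ((hasDerivAt_id x).const_mul (-a)).exp
    refine (hexp.mul hNF).neg.congr_deriv ?_
    rw [map_sub, map_smul, smul_eq_mul]
    ring
  have hlim : Tendsto (fun t => -(Real.exp (-a * t) * N t F)) atTop (𝓝 0) := by
    have hexp : Tendsto (fun t : ℝ => Real.exp (-a * t)) atTop (𝓝 0) :=
      Real.tendsto_exp_atBot.comp (tendsto_id.const_mul_atTop_of_neg (neg_lt_zero.2 ha))
    refine squeeze_zero_norm (a := fun t => Real.exp (-a * t) * (C * ‖F‖)) (fun t => ?_)
      (by simpa using hexp.mul_const (C * ‖F‖))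
    rw [norm_neg, norm_mul, Real.norm_of_nonneg (Real.exp_pos _).le]
    gcongr
    exact (N t).le_of_opNorm_le (hC t) F
  have hcont : Continuous fun t => -(Real.exp (-a * t) * N t F) :=
    ((by fun_prop : Continuous fun t : ℝ => Real.exp (-a * t)).mul (hN F)).neg
  have hzero : N 0 F = 0 := by simpa using hFG 0 le_rfl
  rw [laplaceFunctional_apply, integral_Ioi_of_hasDerivAt_of_tendsto hcont.continuousWithinAt hderiv
    (integrableOn_exp_neg_mul_of_bounded (hN _) (fun t => (N t).le_of_opNorm_le (hC t) _) ha) hlim]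
  simp [hzero]

theorem IsDissipative.eq_zero_of_forward_equation {A : E →ₗ.[ℝ] E} (hA : IsDissipative A) {l : ℝ}
    (hl : 0 < l) (hdense : DenseRange fun F : A.domain => l • (F : E) - A F)
    {N : ℝ → StrongDual ℝ E} {C : ℝ} (hC : ∀ t, ‖N t‖ ≤ C) (hN : ∀ f, Continuous fun t => N t f)
    (hforward : ∀ (F : A.domain) (T : ℝ), 0 ≤ T → N T F = ∫ t in (0 : ℝ)..T, N t (A F))
    {t : ℝ} (ht : 0 ≤ t) : N t = 0 := by
  ext f
  refine eq_zero_of_laplace_eq_zero (hN f) (fun t => (N t).le_of_opNorm_le (hC t) f)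
    (fun a ha => ?_) ht
  have hzero : laplaceFunctional N hC hN ha = 0 := by
    refine DFunLike.coe_injective ((hA.denseRange_smul_sub hl hdense ha).equalizer
      (ContinuousLinearMap.continuous _) continuous_const (funext fun F => ?_))
    exact laplaceFunctional_smul_sub_eq_zero hC hN ha (hforward F)
  rw [← laplaceFunctional_apply N hC hN ha, hzero, zero_apply]

end Dissipative

section InfinitesimalGenerator

variable {E : Type*} [NormedAddCommGroup E] [NormedSpace ℝ E] {T : ℝ≥0 → E →ₗ[ℝ] E}

theorem tendsto_infinitesimalGenerator (F : (infinitesimalGenerator T).domain) :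
    Tendsto (fun t : ℝ≥0 => (t : ℝ)⁻¹ • (T t F - F)) (𝓝[>] 0) (𝓝 (infinitesimalGenerator T F)) :=
  F.2.choose_spec

theorem isDissipative_infinitesimalGenerator (hnorm : ∀ t f, ‖T t f‖ ≤ ‖f‖) :
    IsDissipative (infinitesimalGenerator T) := fun m hm F => by
  refine ge_of_tendsto (tendsto_const_nhds.sub (tendsto_infinitesimalGenerator F)).norm ?_
  filter_upwards [self_mem_nhdsWithin] with t (ht : 0 < t)
  have hinv : (0 : ℝ) < (t : ℝ)⁻¹ := by positivity
  calc m * ‖(F : E)‖ = (m + (t : ℝ)⁻¹) * ‖(F : E)‖ - (t : ℝ)⁻¹ * ‖(F : E)‖ := by ring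
    _ ≤ ‖(m + (t : ℝ)⁻¹) • (F : E)‖ - ‖(t : ℝ)⁻¹ • T t F‖ := by
        rw [norm_smul, norm_smul, Real.norm_of_nonneg hinv.le, Real.norm_of_nonneg (by positivity)]
        gcongr
        exact hnorm t F
    _ ≤ ‖(m + (t : ℝ)⁻¹) • (F : E) - (t : ℝ)⁻¹ • T t F‖ := norm_sub_norm_le _ _
    _ = ‖m • (F : E) - (t : ℝ)⁻¹ • (T t F - F)‖ := by rw [add_smul, smul_sub]; abel_nf

theorem tendsto_semigroup_infinitesimalGenerator (hnorm : ∀ t f, ‖T t f‖ ≤ ‖f‖)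
    (hadd : ∀ s t f, T (s + t) f = T s (T t f)) (t : ℝ≥0)
    (F : (infinitesimalGenerator T).domain) :
    Tendsto (fun r : ℝ≥0 => (r : ℝ)⁻¹ • (T (t + r) F - T t F)) (𝓝[>] 0)
      (𝓝 (T t (infinitesimalGenerator T F))) := by
  have hcont : Continuous (T t) :=
    AddMonoidHomClass.continuous_of_bound (T t) 1 fun f => by simpa using hnorm t f
  refine ((hcont.tendsto _).comp (tendsto_infinitesimalGenerator F)).congr fun r => ?_
  rw [Function.comp_apply, map_smul, map_sub, hadd]

variable {G : Type*} [NormedAddCommGroup G] [NormedSpace ℝ G]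

theorem hasDerivWithinAt_semigroup_Ioi (hnorm : ∀ t f, ‖T t f‖ ≤ ‖f‖)
    (hadd : ∀ s t f, T (s + t) f = T s (T t f)) (φ : E →L[ℝ] G)
    (F : (infinitesimalGenerator T).domain) {t : ℝ} (ht : 0 ≤ t) :
    HasDerivWithinAt (fun t : ℝ => φ (T t.toNNReal F))
      (φ (T t.toNNReal (infinitesimalGenerator T F))) (Set.Ioi t) t := by
  rw [hasDerivWithinAt_iff_tendsto_slope' (by simp)]
  have hshift : Tendsto (fun r : ℝ => (r - t).toNNReal) (𝓝[>] t) (𝓝[>] 0) := by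
    refine tendsto_nhdsWithin_iff.2 ⟨?_, ?_⟩
    · have hcont : Continuous fun r : ℝ => (r - t).toNNReal := by fun_prop
      exact (hcont.tendsto' t 0 (by simp)).mono_left nhdsWithin_le_nhds
    · filter_upwards [self_mem_nhdsWithin] with r hr
      simpa using hr
  refine ((φ.continuous.tendsto _).comp ((tendsto_semigroup_infinitesimalGenerator hnorm hadd
    t.toNNReal F).comp hshift)).congr' ?_
  filter_upwards [self_mem_nhdsWithin] with r (hr : t < r)
  have hsum : t.toNNReal + (r - t).toNNReal = r.toNNReal := by
    rw [← Real.toNNReal_add ht (sub_nonneg.2 hr.le), add_sub_cancel]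
  simp only [Function.comp_apply, hsum, Real.coe_toNNReal _ (sub_nonneg.2 hr.le), map_smul, map_sub,
    slope_def_module]

theorem integral_semigroup_infinitesimalGenerator [CompleteSpace G] (hnorm : ∀ t f, ‖T t f‖ ≤ ‖f‖)
    (hadd : ∀ s t f, T (s + t) f = T s (T t f)) (φ : E →L[ℝ] G)
    (hφ : ∀ f, Continuous fun t => φ (T t f)) (F : (infinitesimalGenerator T).domain) (a : ℝ≥0) :
    ∫ t in (0 : ℝ)..a, φ (T t.toNNReal (infinitesimalGenerator T F)) = φ (T a F) - φ (T 0 F) := by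
  have hcont : ∀ f, Continuous fun t : ℝ => φ (T t.toNNReal f) := fun f =>
    (hφ f).comp continuous_real_toNNReal
  rw [intervalIntegral.integral_eq_sub_of_hasDeriv_right_of_le a.coe_nonneg (hcont F).continuousOn
    (fun t ht => hasDerivWithinAt_semigroup_Ioi hnorm hadd φ F ht.1.le)
    ((hcont _).intervalIntegrable _ _), Real.toNNReal_coe, Real.toNNReal_zero]

end InfinitesimalGenerator

section FiniteMeasure

variable {Ω : Type*} [MeasurableSpace Ω] {P : Measure Ω}

theorem norm_integral_le_of_forall_norm_le [IsProbabilityMeasure P] {a : Ω → ℝ} {C : ℝ}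
    (hC : ∀ ω, ‖a ω‖ ≤ C) : ‖∫ ω, a ω ∂P‖ ≤ C := by
  simpa using norm_integral_le_of_norm_le_const (μ := P) (Eventually.of_forall hC)

variable [IsFiniteMeasure P] {u : ℝ → Ω → ℝ} {B C : ℝ}

theorem integral_intervalIntegral_swap_of_continuous (huc : ∀ ω, Continuous fun t => u t ω)
    (hum : ∀ t, Measurable (u t)) (huC : ∀ t ω, ‖u t ω‖ ≤ C) (a b : ℝ) :
    ∫ ω, (∫ t in a..b, u t ω) ∂P = ∫ t in a..b, (∫ ω, u t ω ∂P) := by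
  refine (intervalIntegral_integral_swap ?_).symm
  have : IsFiniteMeasure (volume.restrict (Set.uIoc a b)) := ⟨by simp [Set.uIoc]⟩
  exact Integrable.of_bound
    (measurable_uncurry_of_continuous_of_measurable huc hum).aestronglyMeasurable C
    (Eventually.of_forall fun p => huC p.1 p.2)

theorem integrable_intervalIntegral_of_continuous (huc : ∀ ω, Continuous fun t => u t ω)
    (hum : ∀ t, Measurable (u t)) (huC : ∀ t ω, ‖u t ω‖ ≤ C) (a b : ℝ) :
    Integrable (fun ω => ∫ t in a..b, u t ω) P := by
  have hu : StronglyMeasurable fun p : Ω × ℝ => u p.2 p.1 :=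
    ((measurable_uncurry_of_continuous_of_measurable huc hum).comp
      measurable_swap).stronglyMeasurable
  refine Integrable.of_bound ?_ (C * |b - a|) (Eventually.of_forall fun ω =>
    intervalIntegral.norm_integral_le_of_norm_le_const fun t _ => huC t ω)
  simp_rw [intervalIntegral]
  exact (hu.integral_prod_right'.sub hu.integral_prod_right').aestronglyMeasurable

theorem integral_mul_sub_sub_intervalIntegral {Φ a b : Ω → ℝ} (hΦ : Measurable Φ)
    (hΦB : ∀ ω, ‖Φ ω‖ ≤ B) (ha : Integrable a P) (hb : Integrable b P)
    (huc : ∀ ω, Continuous fun t => u t ω) (hum : ∀ t, Measurable (u t))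
    (huC : ∀ t ω, ‖u t ω‖ ≤ C) (T : ℝ) :
    ∫ ω, Φ ω * (a ω - b ω - ∫ t in (0 : ℝ)..T, u t ω) ∂P =
      ∫ ω, Φ ω * a ω ∂P - ∫ ω, Φ ω * b ω ∂P - ∫ t in (0 : ℝ)..T, (∫ ω, Φ ω * u t ω ∂P) := by
  have hmul {v : Ω → ℝ} (hv : Integrable v P) : Integrable (fun ω => Φ ω * v ω) P :=
    hv.bdd_mul hΦ.aestronglyMeasurable (Eventually.of_forall hΦB)
  have hswap : ∫ ω, Φ ω * (∫ t in (0 : ℝ)..T, u t ω) ∂P =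
      ∫ t in (0 : ℝ)..T, (∫ ω, Φ ω * u t ω ∂P) := by
    simp_rw [← intervalIntegral.integral_const_mul]
    refine integral_intervalIntegral_swap_of_continuous (u := fun t ω => Φ ω * u t ω) (C := B * C)
      (fun ω => continuous_const.mul (huc ω)) (fun t => hΦ.mul (hum t)) (fun t ω => ?_) 0 T
    rw [norm_mul]
    exact mul_le_mul (hΦB ω) (huC t ω) (norm_nonneg _) ((norm_nonneg _).trans (hΦB ω))
  simp_rw [mul_sub]
  rw [integral_sub (by exact (hmul ha).sub (hmul hb))
      (hmul (integrable_intervalIntegral_of_continuous huc hum huC 0 T)),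
    integral_sub (hmul ha) (hmul hb), hswap]

end FiniteMeasure

namespace MarkovFamily

section MarkovProperty

variable {M : Type*} [MeasurableSpace M] (X : MarkovFamily M)

theorem processPast_le (x : M) (s : ℝ≥0) : processPast (X.X x) s ≤ X.mΩ x :=
  iSup_le fun u => (X.measurable_X x u).comap_le

theorem measurable_processPast (x : M) {u s : ℝ≥0} (hu : u ≤ s) :
    Measurable[processPast (X.X x) s] (X.X x u) :=
  Measurable.of_comap_le (le_iSup (fun u : Set.Iic s => MeasurableSpace.comap (X.X x u) _) ⟨u, hu⟩)

/-- The transition kernel `p(t, x, B)` of a Markov family. -/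
noncomputable def transition (t : ℝ≥0) : Kernel M M where
  toFun x := (X.P x).map (X.X x t)
  measurable' := Measure.measurable_of_measurable_coe _ fun B hB => by
    simp_rw [Measure.map_apply (X.measurable_X _ t) hB]
    exact X.measurable_trans t B hB

theorem transition_apply (t : ℝ≥0) (x : M) : X.transition t x = (X.P x).map (X.X x t) := rfl

instance (t : ℝ≥0) : IsMarkovKernel (X.transition t) :=
  ⟨fun x => Measure.isProbabilityMeasure_map (X.measurable_X x t).aemeasurable⟩

theorem integral_transition (t : ℝ≥0) (x : M) {g : M → ℝ} (hg : Measurable g) :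
    ∫ z, g z ∂(X.transition t x) = ∫ ω, g (X.X x t ω) ∂(X.P x) :=
  integral_map (X.measurable_X x t).aemeasurable hg.aestronglyMeasurable

theorem setLIntegral_transition (x : M) (s t : ℝ≥0) {A : Set (X.Ω x)}
    (hA : MeasurableSet[processPast (X.X x) s] A) {B : Set M} (hB : MeasurableSet B) :
    ∫⁻ ω in A, X.transition t (X.X x s ω) B ∂(X.P x) =
      (X.P x).restrict A (X.X x (s + t) ⁻¹' B) := by
  have hreal (z : M) :
      X.transition t z B = ENNReal.ofReal ((X.P z).real (X.X z t ⁻¹' B)) := by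
    rw [transition_apply, Measure.map_apply (X.measurable_X z t) hB, ofReal_measureReal]
  have hint : Integrable (fun ω => (X.P (X.X x s ω)).real (X.X (X.X x s ω) t ⁻¹' B))
      ((X.P x).restrict A) :=
    Integrable.of_bound ((X.measurable_trans t B hB).ennreal_toReal.comp
      (X.measurable_X x s)).aestronglyMeasurable 1 (Eventually.of_forall fun ω => by
        rw [Real.norm_of_nonneg measureReal_nonneg]
        exact measureReal_le_one)
  have hpre := X.measurable_X x (s + t) hB
  have hcond := setIntegral_condExp (X.processPast_le x s) (μ := X.P x)
    ((integrable_const (1 : ℝ)).indicator hpre) hA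
  rw [setIntegral_congr_ae (X.processPast_le x s A hA)
      ((X.markov x s t B hB).mono fun ω h _ => h),
    integral_indicator_const _ hpre, smul_eq_mul, mul_one] at hcond
  simp_rw [hreal]
  rw [← ofReal_integral_eq_lintegral_ofReal hint (Eventually.of_forall fun _ => measureReal_nonneg),
    hcond, ofReal_measureReal]

theorem map_restrict_eq_transition_comp (x : M) (s t : ℝ≥0) {A : Set (X.Ω x)}
    (hA : MeasurableSet[processPast (X.X x) s] A) :
    ((X.P x).restrict A).map (X.X x (s + t)) =
      X.transition t ∘ₘ ((X.P x).restrict A).map (X.X x s) := by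
  ext B hB
  rw [Measure.map_apply (X.measurable_X x (s + t)) hB,
    Measure.bind_apply hB (X.transition t).measurable.aemeasurable,
    lintegral_map ((X.transition t).measurable_coe hB) (X.measurable_X x s),
    X.setLIntegral_transition x s t hA hB]

theorem condExp_comp (x : M) (s t : ℝ≥0) {g : M → ℝ} (hg : Measurable g) {C : ℝ}
    (hC : ∀ z, ‖g z‖ ≤ C) :
    (X.P x)[fun ω => g (X.X x (s + t) ω) | processPast (X.X x) s] =ᵐ[X.P x]
      fun ω => ∫ z, g z ∂(X.transition t (X.X x s ω)) := by
  have hgm : StronglyMeasurable fun x => ∫ z, g z ∂(X.transition t x) :=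
    hg.stronglyMeasurable.integral_kernel
  have hgi : ∀ (μ : Measure M) [IsFiniteMeasure μ], Integrable g μ := fun μ _ =>
    Integrable.of_bound hg.aestronglyMeasurable C (Eventually.of_forall hC)
  refine (ae_eq_condExp_of_forall_setIntegral_eq (X.processPast_le x s)
    ((hgi _).comp_measurable (X.measurable_X x (s + t))) (fun A _ _ => ?_) (fun A hA _ => ?_)
    (hgm.comp_measurable (X.measurable_processPast x le_rfl)).aestronglyMeasurable).symm
  · exact Integrable.of_bound (hgm.comp_measurable (X.measurable_X x s)).aestronglyMeasurable C
      (Eventually.of_forall fun ω => norm_integral_le_of_forall_norm_le hC)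
  · simp only [Function.comp_apply]
    rw [← integral_map (X.measurable_X x (s + t)).aemeasurable hg.aestronglyMeasurable,
      ← integral_map (X.measurable_X x s).aemeasurable hgm.aestronglyMeasurable,
      X.map_restrict_eq_transition_comp x s t hA, Measure.comp_eq_comp_const_apply,
      Kernel.integral_comp (hgi _), Kernel.const_apply]

theorem integral_mul_comp (x : M) (s t : ℝ≥0) {g : M → ℝ} (hg : Measurable g) {C : ℝ}
    (hC : ∀ z, ‖g z‖ ≤ C) {Φ : X.Ω x → ℝ} (hΦ : Measurable[processPast (X.X x) s] Φ) {B : ℝ}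
    (hB : ∀ ω, ‖Φ ω‖ ≤ B) :
    ∫ ω, Φ ω * g (X.X x (s + t) ω) ∂(X.P x) =
      ∫ ω, Φ ω * ∫ z, g z ∂(X.transition t (X.X x s ω)) ∂(X.P x) := by
  have hgi : Integrable (fun ω => g (X.X x (s + t) ω)) (X.P x) :=
    Integrable.of_bound (hg.comp (X.measurable_X x (s + t))).aestronglyMeasurable C
      (Eventually.of_forall fun _ => hC _)
  have hmul : Integrable (Φ * fun ω => g (X.X x (s + t) ω)) (X.P x) :=
    hgi.bdd_mul (hΦ.mono (X.processPast_le x s) le_rfl).aestronglyMeasurable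
      (Eventually.of_forall hB)
  rw [← integral_condExp (X.processPast_le x s) (f := fun ω => Φ ω * g (X.X x (s + t) ω))]
  refine integral_congr_ae ?_
  filter_upwards [condExp_mul_of_stronglyMeasurable_left hΦ.stronglyMeasurable hmul hgi,
    X.condExp_comp x s t hg hC] with ω hpull hcomp
  rw [← hcomp]
  exact hpull

end MarkovProperty

end MarkovFamily

section PathSpace

open scoped BoundedContinuousFunction

variable {S : Type*} [TopologicalSpace S]

/-- The increment over `[s, s + T]` of the process `f (w t) - ∫₀ᵗ g (w r) dr` attached by Dynkin's
formula to a pair `(f, g)`, as a bounded continuous function of the path `w`. -/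
noncomputable def dynkinIncrement (f g : S →ᵇ ℝ) (s T : ℝ≥0) : C(ℝ≥0, S) →ᵇ ℝ :=
  .ofNormedAddCommGroup
    (fun w => f (w (s + T)) - f (w s) - ∫ t in (0 : ℝ)..T, g (w (s + t.toNNReal)))
    (by
      have heval (t : ℝ≥0) : Continuous fun w : C(ℝ≥0, S) => f (w t) :=
        f.continuous.comp (continuous_eval_const t)
      refine ((heval _).sub (heval _)).sub
        (intervalIntegral.continuous_parametric_intervalIntegral_of_continuous' ?_ _ _)
      exact g.continuous.comp
        (continuous_fst.eval (continuous_const.add (continuous_real_toNNReal.comp continuous_snd))))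
    (‖f‖ + ‖f‖ + ‖g‖ * T)
    (fun w => by
      have hg := intervalIntegral.norm_integral_le_of_norm_le_const (a := 0) (b := T)
        (f := fun t => g (w (s + t.toNNReal))) fun t _ => g.norm_coe_le_norm _
      rw [sub_zero, NNReal.abs_eq] at hg
      exact (norm_sub_le _ _).trans (add_le_add ((norm_sub_le _ _).trans
        (add_le_add (f.norm_coe_le_norm _) (f.norm_coe_le_norm _))) hg))

theorem dynkinIncrement_apply (f g : S →ᵇ ℝ) (s T : ℝ≥0) (w : C(ℝ≥0, S)) :
    dynkinIncrement f g s T w =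
      f (w (s + T)) - f (w s) - ∫ t in (0 : ℝ)..T, g (w (s + t.toNNReal)) :=
  rfl

/-- The cylinder function `w ↦ ∏ t ∈ J, φ t (w t)` on path space; these serve as test functions of
the past in the martingale problem and determine the finite-dimensional distributions. -/
noncomputable def cylinderFunction (J : Finset ℝ≥0) (φ : ℝ≥0 → S →ᵇ ℝ) : C(ℝ≥0, S) →ᵇ ℝ :=
  ∏ t ∈ J, (φ t).compContinuous ⟨fun w => w t, continuous_eval_const t⟩

theorem cylinderFunction_apply (J : Finset ℝ≥0) (φ : ℝ≥0 → S →ᵇ ℝ) (w : C(ℝ≥0, S)) :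
    cylinderFunction J φ w = ∏ t ∈ J, φ t (w t) :=
  BoundedContinuousFunction.prod_apply _ _ _

/-- `μ` solves the martingale problem for the operator `A`: for all `F` in the domain of `A` the
process `F (w t) - ∫₀ᵗ (A F) (w r) dr` is a martingale under `μ`, in the sense that its increments
after time `s` are orthogonal to the cylinder functions of the path up to time `s`. -/
def SolvesMartingaleProblem (A : C₀(S, ℝ) →ₗ.[ℝ] C₀(S, ℝ)) (μ : Measure C(ℝ≥0, S)) : Prop :=
  ∀ (F : A.domain) (J : Finset ℝ≥0) (φ : ℝ≥0 → S →ᵇ ℝ) (s T : ℝ≥0), (∀ t ∈ J, t ≤ s) →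
    ∫ w, cylinderFunction J φ w *
      dynkinIncrement (F : C₀(S, ℝ)).toBCF (A F).toBCF s T w ∂μ = 0

theorem SolvesMartingaleProblem.mono {A B : C₀(S, ℝ) →ₗ.[ℝ] C₀(S, ℝ)} {μ : Measure C(ℝ≥0, S)}
    (hμ : SolvesMartingaleProblem B μ) (hAB : A ≤ B) : SolvesMartingaleProblem A μ := by
  intro F
  rw [hAB.2 (x := F) (y := ⟨F, hAB.1 F.2⟩) rfl]
  exact hμ ⟨F, hAB.1 F.2⟩

theorem exists_zeroAtInfty_eq_mul (g : S →ᵇ ℝ) (f : C₀(S, ℝ)) :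
    ∃ k : C₀(S, ℝ), ∀ y, k y = g y * f y := by
  refine ⟨⟨⟨fun y => g y * f y, g.continuous.mul f.continuous⟩, ?_⟩, fun _ => rfl⟩
  refine squeeze_zero_norm (a := fun y => ‖g‖ * ‖f y‖) (fun y => ?_) ?_
  · rw [norm_mul]
    gcongr
    exact g.norm_coe_le_norm y
  · simpa using (zero_at_infty f).norm.const_mul ‖g‖

theorem exists_seq_zeroAtInfty_tendsto_one [T2Space S] [WeaklyLocallyCompactSpace S]
    [SigmaCompactSpace S] : ∃ f : ℕ → C₀(S, ℝ),
      (∀ n y, ‖f n y‖ ≤ 1) ∧ ∀ y, Tendsto (fun n => f n y) atTop (𝓝 1) := by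
  let K := CompactExhaustion.choice S
  have hcutoff (n : ℕ) : ∃ f : C₀(S, ℝ), (∀ y ∈ K n, f y = 1) ∧ ∀ y, ‖f y‖ ≤ 1 := by
    obtain ⟨f, hone, -, hsupp, hf⟩ :=
      exists_continuous_one_zero_of_isCompact (K.isCompact n) isClosed_empty (by simp)
    exact ⟨⟨f, hsupp.is_zero_at_infty⟩, fun y hy => hone hy,
      fun y => abs_le.2 ⟨(neg_nonpos.2 zero_le_one).trans (hf y).1, (hf y).2⟩⟩
  choose f hone hbound using hcutoff
  refine ⟨f, hbound, fun y => tendsto_const_nhds.congr' ?_⟩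
  filter_upwards [eventually_ge_atTop (K.find y)] with n hn
  exact (hone n y (K.subset hn (K.mem_find y))).symm

section WeightedMarginal

variable (μ : Measure C(ℝ≥0, S)) [IsFiniteMeasure μ] (Φ : C(ℝ≥0, S) →ᵇ ℝ) (t : ℝ≥0)

theorem measurable_zeroAtInfty_eval (f : C₀(S, ℝ)) :
    Measurable fun w : C(ℝ≥0, S) => f (w t) :=
  (f.continuous.comp (continuous_eval_const t)).measurable

theorem integrable_zeroAtInfty_eval (f : C₀(S, ℝ)) :
    Integrable (fun w : C(ℝ≥0, S) => f (w t)) μ :=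
  .of_bound (measurable_zeroAtInfty_eval t f).aestronglyMeasurable ‖f.toBCF‖
    (.of_forall fun w => f.toBCF.norm_coe_le_norm (w t))

theorem norm_mul_zeroAtInfty_eval_le (f : C₀(S, ℝ)) (w : C(ℝ≥0, S)) :
    ‖Φ w * f (w t)‖ ≤ ‖Φ‖ * ‖f‖ := by
  rw [norm_mul]
  gcongr
  exacts [Φ.norm_coe_le_norm w, f.toBCF.norm_coe_le_norm (w t)]

theorem integrable_mul_zeroAtInfty_eval (f : C₀(S, ℝ)) :
    Integrable (fun w : C(ℝ≥0, S) => Φ w * f (w t)) μ :=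
  (integrable_zeroAtInfty_eval μ t f).bdd_mul Φ.continuous.measurable.aestronglyMeasurable
    (.of_forall Φ.norm_coe_le_norm)

/-- The marginal at time `t` of the signed measure `Φ μ` on path space, acting on `C₀(S)`. -/
noncomputable def weightedMarginal : StrongDual ℝ C₀(S, ℝ) :=
  LinearMap.mkContinuous
    { toFun := fun f => ∫ w, Φ w * f (w t) ∂μ
      map_add' := fun f g => by
        rw [← integral_add (integrable_mul_zeroAtInfty_eval μ Φ t f)
          (integrable_mul_zeroAtInfty_eval μ Φ t g)]
        exact integral_congr_ae (.of_forall fun w => mul_add _ _ _)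
      map_smul' := fun c f => by
        rw [RingHom.id_apply, smul_eq_mul, ← integral_const_mul]
        exact integral_congr_ae (.of_forall fun w => mul_left_comm _ _ _) }
    (‖Φ‖ * μ.real Set.univ) fun f => by
      rw [mul_right_comm]
      exact norm_integral_le_of_norm_le_const
        (.of_forall fun w => norm_mul_zeroAtInfty_eval_le Φ t f w)

theorem weightedMarginal_apply (f : C₀(S, ℝ)) :
    weightedMarginal μ Φ t f = ∫ w, Φ w * f (w t) ∂μ := rfl

theorem norm_weightedMarginal_le : ‖weightedMarginal μ Φ t‖ ≤ ‖Φ‖ * μ.real Set.univ :=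
  LinearMap.mkContinuous_norm_le _ (by positivity) _

theorem continuous_weightedMarginal_apply (f : C₀(S, ℝ)) :
    Continuous fun t => weightedMarginal μ Φ t f :=
  continuous_of_dominated
    (fun t => (integrable_mul_zeroAtInfty_eval μ Φ t f).aestronglyMeasurable)
    (fun t => .of_forall (norm_mul_zeroAtInfty_eval_le Φ t f)) (integrable_const _)
    (.of_forall fun w => continuous_const.mul (f.continuous.comp w.continuous))

theorem weightedMarginal_cylinderFunction_insert {J : Finset ℝ≥0} {φ : ℝ≥0 → S →ᵇ ℝ} (ht : t ∉ J)
    {f k : C₀(S, ℝ)} (hk : ∀ y, k y = φ t y * f y) :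
    weightedMarginal μ (cylinderFunction (insert t J) φ) t f =
      weightedMarginal μ (cylinderFunction J φ) t k := by
  simp only [weightedMarginal_apply, cylinderFunction_apply, Finset.prod_insert ht, hk]
  exact integral_congr_ae (.of_forall fun w => by ring)

theorem integral_eq_of_weightedMarginal_eq [T2Space S] [WeaklyLocallyCompactSpace S]
    [SigmaCompactSpace S] {ν : Measure C(ℝ≥0, S)} [IsFiniteMeasure ν]
    (h : weightedMarginal μ Φ t = weightedMarginal ν Φ t) : ∫ w, Φ w ∂μ = ∫ w, Φ w ∂ν := by
  obtain ⟨f, hf_le, hf_tendsto⟩ := exists_seq_zeroAtInfty_tendsto_one (S := S)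
  have hlim (ρ : Measure C(ℝ≥0, S)) [IsFiniteMeasure ρ] :
      Tendsto (fun n => weightedMarginal ρ Φ t (f n)) atTop (𝓝 (∫ w, Φ w ∂ρ)) := by
    refine tendsto_integral_of_dominated_convergence (fun _ => ‖Φ‖)
      (fun n => (integrable_mul_zeroAtInfty_eval ρ Φ t (f n)).aestronglyMeasurable)
      (integrable_const _) (fun n => .of_forall fun w => ?_) (.of_forall fun w => ?_)
    · rw [norm_mul, ← mul_one ‖Φ‖]
      gcongr
      exacts [Φ.norm_coe_le_norm w, hf_le n _]
    · simpa using (hf_tendsto (w t)).const_mul (Φ w)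
  exact tendsto_nhds_unique (hlim μ) (h ▸ hlim ν)

end WeightedMarginal

section Uniqueness

variable {A : C₀(S, ℝ) →ₗ.[ℝ] C₀(S, ℝ)} {μ ν : Measure C(ℝ≥0, S)} [IsFiniteMeasure μ]
  [IsFiniteMeasure ν] {J : Finset ℝ≥0} {s : ℝ≥0}

theorem SolvesMartingaleProblem.weightedMarginal_sub_eq_integral
    (hμ : SolvesMartingaleProblem A μ) (φ : ℝ≥0 → S →ᵇ ℝ) (hJ : ∀ t ∈ J, t ≤ s) (T : ℝ≥0)
    (F : A.domain) :
    weightedMarginal μ (cylinderFunction J φ) (s + T) F -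
        weightedMarginal μ (cylinderFunction J φ) s F =
      ∫ t in (0 : ℝ)..T, weightedMarginal μ (cylinderFunction J φ) (s + t.toNNReal) (A F) := by
  refine sub_eq_zero.1 (Eq.trans (Eq.symm ?_) (hμ F J φ s T hJ))
  exact integral_mul_sub_sub_intervalIntegral (u := fun t w => A F (w (s + t.toNNReal)))
    (cylinderFunction J φ).continuous.measurable (cylinderFunction J φ).norm_coe_le_norm
    (integrable_zeroAtInfty_eval μ (s + T) F) (integrable_zeroAtInfty_eval μ s F)
    (fun w => (A F).continuous.comp
      (w.continuous.comp (continuous_const.add continuous_real_toNNReal)))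
    (fun t => measurable_zeroAtInfty_eval (s + t.toNNReal) (A F))
    (fun t w => (A F).toBCF.norm_coe_le_norm (w (s + t.toNNReal))) T

theorem SolvesMartingaleProblem.weightedMarginal_add_eq (hA : IsDissipative A) {l : ℝ} (hl : 0 < l)
    (hdense : DenseRange fun F : A.domain => l • (F : C₀(S, ℝ)) - A F)
    (hμ : SolvesMartingaleProblem A μ) (hν : SolvesMartingaleProblem A ν) {φ : ℝ≥0 → S →ᵇ ℝ}
    (hJ : ∀ t ∈ J, t ≤ s)
    (hs : weightedMarginal μ (cylinderFunction J φ) s =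
      weightedMarginal ν (cylinderFunction J φ) s) (r : ℝ≥0) :
    weightedMarginal μ (cylinderFunction J φ) (s + r) =
      weightedMarginal ν (cylinderFunction J φ) (s + r) := by
  let Φ := cylinderFunction J φ
  let N : ℝ → StrongDual ℝ C₀(S, ℝ) := fun t =>
    weightedMarginal μ Φ (s + t.toNNReal) - weightedMarginal ν Φ (s + t.toNNReal)
  have hcont (ρ : Measure C(ℝ≥0, S)) [IsFiniteMeasure ρ] (f : C₀(S, ℝ)) :
      Continuous fun t : ℝ => weightedMarginal ρ Φ (s + t.toNNReal) f :=
    (continuous_weightedMarginal_apply ρ Φ f).comp (continuous_const.add continuous_real_toNNReal)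
  have hforward (F : A.domain) (T : ℝ) (hT : 0 ≤ T) : N T F = ∫ t in (0 : ℝ)..T, N t (A F) := by
    lift T to ℝ≥0 using hT
    simp only [N, sub_apply, Real.toNNReal_coe]
    rw [intervalIntegral.integral_sub ((hcont μ _).intervalIntegrable _ _)
        ((hcont ν _).intervalIntegrable _ _), ← hμ.weightedMarginal_sub_eq_integral φ hJ,
      ← hν.weightedMarginal_sub_eq_integral φ hJ, hs, sub_sub_sub_cancel_right]
  have hN_zero : N r = 0 :=
    hA.eq_zero_of_forward_equation hl hdense
      (fun t => (norm_sub_le _ _).trans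
        (add_le_add (norm_weightedMarginal_le μ Φ _) (norm_weightedMarginal_le ν Φ _)))
      (fun f => (hcont μ f).sub (hcont ν f)) hforward r.coe_nonneg
  rwa [← sub_eq_zero, ← Real.toNNReal_coe (r := r)]

theorem SolvesMartingaleProblem.weightedMarginal_eq (hA : IsDissipative A) {l : ℝ} (hl : 0 < l)
    (hdense : DenseRange fun F : A.domain => l • (F : C₀(S, ℝ)) - A F)
    (hμ : SolvesMartingaleProblem A μ) (hν : SolvesMartingaleProblem A ν)
    (hinit : ∀ f : C₀(S, ℝ), ∫ w, f (w 0) ∂μ = ∫ w, f (w 0) ∂ν) (φ : ℝ≥0 → S →ᵇ ℝ)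
    (hJ : ∀ t ∈ J, t ≤ s) :
    weightedMarginal μ (cylinderFunction J φ) s =
      weightedMarginal ν (cylinderFunction J φ) s := by
  induction J using Finset.induction_on_max generalizing s with
  | empty =>
    rw [← zero_add s]
    refine hμ.weightedMarginal_add_eq hA hl hdense hν (by simp) ?_ s
    ext f
    simpa [weightedMarginal_apply, cylinderFunction_apply] using hinit f
  | insert a J hmax ih =>
    obtain ⟨r, rfl⟩ := exists_add_of_le (hJ a (Finset.mem_insert_self a J))
    refine hμ.weightedMarginal_add_eq hA hl hdense hν ?_ ?_ r
    · exact (Finset.forall_mem_insert _ _ _).2 ⟨le_rfl, fun t ht => (hmax t ht).le⟩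
    ext f
    obtain ⟨k, hk⟩ := exists_zeroAtInfty_eq_mul (φ a) f
    have ha : a ∉ J := fun h => (hmax a h).false
    rw [weightedMarginal_cylinderFunction_insert μ a ha hk,
      weightedMarginal_cylinderFunction_insert ν a ha hk, ih fun t ht => (hmax t ht).le]

end Uniqueness

end PathSpace

section PathSpaceExt

open scoped BoundedContinuousFunction

theorem ext_of_integral_prod_boundedContinuousFunction {ι : Type*} [Fintype ι] {E : ι → Type*}
    [∀ i, MeasurableSpace (E i)] [∀ i, TopologicalSpace (E i)] [∀ i, BorelSpace (E i)]
    [∀ i, HasOuterApproxClosed (E i)] {μ ν : Measure (Π i, E i)} [IsFiniteMeasure μ]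
    [IsFiniteMeasure ν]
    (h : ∀ φ : Π i, E i →ᵇ ℝ, ∫ x, ∏ i, φ i (x i) ∂μ = ∫ x, ∏ i, φ i (x i) ∂ν) : μ = ν := by
  have hprod : μ.prod (Measure.dirac ()) = ν.prod (Measure.dirac ()) :=
    Measure.ext_of_integral_prod_mul_boundedContinuousFunction fun φ g => by
      rw [integral_prod_mul (fun x : Π i, E i => ∏ i, φ i (x i)) g, h,
        ← integral_prod_mul (fun x : Π i, E i => ∏ i, φ i (x i)) g]
  simpa using congrArg Measure.fst hprod

variable {S : Type*} [MetricSpace S] [TopologicalSpace.SeparableSpace S]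

theorem borel_path_le_comap_pi [MeasurableSpace S] [BorelSpace S] :
    (pathMeasurableSpace : MeasurableSpace C(ℝ≥0, S)) ≤
      MeasurableSpace.comap (fun w t => w t) MeasurableSpace.pi := by
  have hid := @measurable_path S _ _ _ _ C(ℝ≥0, S)
    (MeasurableSpace.comap (fun w t => w t) MeasurableSpace.pi) (fun t w => w t)
    (fun t => (measurable_pi_apply t).comp (comap_measurable _)) (fun w => w.continuous)
  exact fun B hB => hid hB

variable {μ ν : Measure C(ℝ≥0, S)} [IsFiniteMeasure μ] [IsFiniteMeasure ν]

theorem ext_of_integral_cylinderFunction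
    (h : ∀ J φ, ∫ w, cylinderFunction J φ w ∂μ = ∫ w, cylinderFunction J φ w ∂ν) : μ = ν := by
  borelize S
  have heval : Measurable fun (w : C(ℝ≥0, S)) t => w t :=
    measurable_pi_lambda _ fun t => (continuous_eval_const t).measurable
  have hrestrict (J : Finset ℝ≥0) : Measurable fun w : C(ℝ≥0, S) => J.restrict fun t => w t :=
    J.measurable_restrict.comp heval
  have hfdd (J : Finset ℝ≥0) : μ.map (fun w => J.restrict fun t => w t) =
      ν.map fun w => J.restrict fun t => w t := by
    refine ext_of_integral_prod_boundedContinuousFunction fun φ => ?_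
    have hφ : Measurable fun x : J → S => ∏ j, φ j (x j) :=
      Finset.measurable_prod _ fun j _ => (φ j).continuous.measurable.comp (measurable_pi_apply j)
    rw [integral_map (hrestrict J).aemeasurable hφ.aestronglyMeasurable,
      integral_map (hrestrict J).aemeasurable hφ.aestronglyMeasurable]
    have hcylinder := h J fun t => if ht : t ∈ J then φ ⟨t, ht⟩ else 0
    simpa [cylinderFunction_apply, ← Finset.prod_coe_sort J] using hcylinder
  have hlaw : μ.map (fun w t => w t) = ν.map fun w t => w t := by
    have hlim := isProjectiveLimit_map (P := μ) heval.aemeasurable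
    simp_rw [hfdd] at hlim
    exact hlim.unique (isProjectiveLimit_map heval.aemeasurable)
  ext B hB
  obtain ⟨B', hB', rfl⟩ := borel_path_le_comap_pi B hB
  rw [← Measure.map_apply heval hB', hlaw, Measure.map_apply heval hB']

theorem SolvesMartingaleProblem.eq [LocallyCompactSpace S]
    {A : C₀(S, ℝ) →ₗ.[ℝ] C₀(S, ℝ)} (hA : IsDissipative A) {l : ℝ} (hl : 0 < l)
    (hdense : DenseRange fun F : A.domain => l • (F : C₀(S, ℝ)) - A F)
    (hμ : SolvesMartingaleProblem A μ) (hν : SolvesMartingaleProblem A ν)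
    (hinit : ∀ f : C₀(S, ℝ), ∫ w, f (w 0) ∂μ = ∫ w, f (w 0) ∂ν) : μ = ν := by
  have : SecondCountableTopology S := UniformSpace.secondCountable_of_separable S
  refine ext_of_integral_cylinderFunction fun J φ => ?_
  exact integral_eq_of_weightedMarginal_eq μ _ (J.sup id)
    (hμ.weightedMarginal_eq hA hl hdense hν hinit φ fun t ht => J.le_sup (f := id) ht)

end PathSpaceExt

namespace MarkovFamily

section DynkinDefect

variable {M : Type*} [MeasurableSpace M] (X : MarkovFamily M) {u v : M → ℝ} {C D : ℝ}

/-- The defect `E (u (X T) - u (X 0) - ∫₀ᵀ v (X t) dt)`, for the process started at `x`, in Dynkin's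
formula for the pair `(u, v)`; it vanishes when `v` is the generator applied to `u`. -/
noncomputable def dynkinDefect (u v : M → ℝ) (T : ℝ≥0) (x : M) : ℝ :=
  ∫ ω, (u (X.X x T ω) - u (X.X x 0 ω) - ∫ t in (0 : ℝ)..T, v (X.X x t.toNNReal ω)) ∂(X.P x)

theorem norm_dynkinDefect_le (huC : ∀ z, ‖u z‖ ≤ C) (hvD : ∀ z, ‖v z‖ ≤ D) (T : ℝ≥0) (x : M) :
    ‖X.dynkinDefect u v T x‖ ≤ C + C + D * T := by
  refine norm_integral_le_of_forall_norm_le fun ω => ?_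
  have hv := intervalIntegral.norm_integral_le_of_norm_le_const (a := 0) (b := T)
    (f := fun t => v (X.X x t.toNNReal ω)) fun t _ => hvD _
  rw [sub_zero, NNReal.abs_eq] at hv
  exact (norm_sub_le _ _).trans
    (add_le_add ((norm_sub_le _ _).trans (add_le_add (huC _) (huC _))) hv)

theorem integrable_comp_of_bound (hu : Measurable u) (huC : ∀ z, ‖u z‖ ≤ C) (t : ℝ≥0) (x : M) :
    Integrable (fun ω => u (X.X x t ω)) (X.P x) :=
  .of_bound (hu.comp (X.measurable_X x t)).aestronglyMeasurable C (.of_forall fun _ => huC _)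

theorem continuous_integral_transition (hv : Measurable v) (hvD : ∀ z, ‖v z‖ ≤ D) {x : M}
    (hvc : ∀ ω, Continuous fun t => v (X.X x t ω)) :
    Continuous fun t => ∫ z, v z ∂(X.transition t x) := by
  simp_rw [X.integral_transition _ x hv]
  exact continuous_of_dominated
    (fun t => (X.integrable_comp_of_bound hv hvD t x).aestronglyMeasurable)
    (fun t => .of_forall fun _ => hvD _) (integrable_const D) (.of_forall hvc)

theorem dynkinDefect_eq (hu : Measurable u) (huC : ∀ z, ‖u z‖ ≤ C) (hv : Measurable v)
    (hvD : ∀ z, ‖v z‖ ≤ D) {x : M} (hvc : ∀ ω, Continuous fun t => v (X.X x t ω)) (T : ℝ≥0) :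
    X.dynkinDefect u v T x = ∫ z, u z ∂(X.transition T x) - ∫ z, u z ∂(X.transition 0 x) -
      ∫ t in (0 : ℝ)..T, ∫ z, v z ∂(X.transition t.toNNReal x) := by
  simpa only [dynkinDefect, one_mul, X.integral_transition _ x hu, X.integral_transition _ x hv]
    using integral_mul_sub_sub_intervalIntegral (Φ := fun _ => (1 : ℝ)) (B := 1)
      (u := fun t ω => v (X.X x t.toNNReal ω)) measurable_const (by simp)
      (X.integrable_comp_of_bound hu huC T x) (X.integrable_comp_of_bound hu huC 0 x)
      (fun ω => (hvc ω).comp continuous_real_toNNReal)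
      (fun t => hv.comp (X.measurable_X x t.toNNReal)) (fun _ _ => hvD _) T

theorem integral_mul_increment_eq_integral_mul_dynkinDefect (hu : Measurable u)
    (huC : ∀ z, ‖u z‖ ≤ C) (hv : Measurable v) (hvD : ∀ z, ‖v z‖ ≤ D)
    (hvc : ∀ x ω, Continuous fun t => v (X.X x t ω)) (x : M) (s T : ℝ≥0) {Φ : X.Ω x → ℝ}
    (hΦ : Measurable[processPast (X.X x) s] Φ) {B : ℝ} (hB : ∀ ω, ‖Φ ω‖ ≤ B) :
    ∫ ω, Φ ω * (u (X.X x (s + T) ω) - u (X.X x s ω) -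
        ∫ t in (0 : ℝ)..T, v (X.X x (s + t.toNNReal) ω)) ∂(X.P x) =
      ∫ ω, Φ ω * X.dynkinDefect u v T (X.X x s ω) ∂(X.P x) := by
  have hΦ' : Measurable Φ := hΦ.mono (X.processPast_le x s) le_rfl
  have hmeas {g : M → ℝ} (hg : Measurable g) (t : ℝ≥0) :
      Measurable fun ω => ∫ z, g z ∂(X.transition t (X.X x s ω)) :=
    hg.stronglyMeasurable.integral_kernel.measurable.comp (X.measurable_X x s)
  have hint (t : ℝ≥0) : Integrable (fun ω => ∫ z, u z ∂(X.transition t (X.X x s ω))) (X.P x) :=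
    .of_bound (hmeas hu t).aestronglyMeasurable C
      (.of_forall fun _ => norm_integral_le_of_forall_norm_le huC)
  have hstart : ∫ ω, Φ ω * u (X.X x s ω) ∂(X.P x) =
      ∫ ω, Φ ω * ∫ z, u z ∂(X.transition 0 (X.X x s ω)) ∂(X.P x) := by
    simpa only [add_zero] using X.integral_mul_comp x s 0 hu huC hΦ hB
  simp_rw [X.dynkinDefect_eq hu huC hv hvD (hvc _)]
  rw [integral_mul_sub_sub_intervalIntegral
      (u := fun t ω => ∫ z, v z ∂(X.transition t.toNNReal (X.X x s ω))) hΦ' hB (hint T) (hint 0)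
      (fun ω => (X.continuous_integral_transition hv hvD (hvc _)).comp continuous_real_toNNReal)
      (fun t => hmeas hv t.toNNReal) (fun _ _ => norm_integral_le_of_forall_norm_le hvD),
    integral_mul_sub_sub_intervalIntegral (u := fun t ω => v (X.X x (s + t.toNNReal) ω)) hΦ' hB
      (X.integrable_comp_of_bound hu huC _ x) (X.integrable_comp_of_bound hu huC _ x)
      (fun ω => (hvc x ω).comp (continuous_const.add continuous_real_toNNReal))
      (fun t => hv.comp (X.measurable_X x _)) (fun _ _ => hvD _), hstart]
  simp_rw [X.integral_mul_comp x s _ hu huC hΦ hB, X.integral_mul_comp x s _ hv hvD hΦ hB]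

end DynkinDefect

section Feller

variable {S : Type*} [MetricSpace S] [MeasurableSpace S] [BorelSpace S] (Y : MarkovFamily S)
  (hY : Y.PreservesC0)

theorem semigroup_apply_eq_integral_transition (t : ℝ≥0) (f : C₀(S, ℝ)) (y : S) :
    Y.semigroup hY t f y = ∫ z, f z ∂(Y.transition t y) := by
  rw [Y.semigroup_apply, Y.integral_transition t y (map_continuous f).measurable]

theorem norm_semigroup_le (t : ℝ≥0) (f : C₀(S, ℝ)) : ‖Y.semigroup hY t f‖ ≤ ‖f‖ :=
  (BoundedContinuousFunction.norm_le (f := (Y.semigroup hY t f).toBCF) (norm_nonneg f)).2 fun y =>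
    (Y.semigroup_apply hY t f y).symm ▸
      norm_integral_le_of_forall_norm_le fun _ => f.toBCF.norm_coe_le_norm _

theorem semigroup_add (s t : ℝ≥0) (f : C₀(S, ℝ)) :
    Y.semigroup hY (s + t) f = Y.semigroup hY s (Y.semigroup hY t f) := by
  ext y
  simpa only [one_mul, ← Y.semigroup_apply_eq_integral_transition hY, ← Y.semigroup_apply hY] using
    Y.integral_mul_comp y s t (map_continuous f).measurable f.toBCF.norm_coe_le_norm
      (measurable_const (a := (1 : ℝ))) (B := 1) (by simp)

theorem continuous_semigroup_apply {y : S} (hYc : ∀ ω, Continuous fun t => Y.X y t ω)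
    (f : C₀(S, ℝ)) : Continuous fun t => Y.semigroup hY t f y := by
  simp_rw [Y.semigroup_apply_eq_integral_transition]
  exact Y.continuous_integral_transition (map_continuous f).measurable f.toBCF.norm_coe_le_norm
    fun ω => f.continuous.comp (hYc ω)

theorem dynkinDefect_generator {y : S} (hYc : ∀ ω, Continuous fun t => Y.X y t ω)
    (F : (Y.generator hY).domain) (T : ℝ≥0) :
    Y.dynkinDefect (F : C₀(S, ℝ)) (Y.generator hY F) T y = 0 := by
  let evalAt : C₀(S, ℝ) →L[ℝ] ℝ := LinearMap.mkContinuous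
    { toFun := fun f => f y, map_add' := fun _ _ => rfl, map_smul' := fun _ _ => rfl } 1
    fun f => (f.toBCF.norm_coe_le_norm y).trans_eq (one_mul _).symm
  have hintegral := integral_semigroup_infinitesimalGenerator (Y.norm_semigroup_le hY)
    (Y.semigroup_add hY) evalAt (Y.continuous_semigroup_apply hY hYc) F T
  rw [Y.dynkinDefect_eq (map_continuous (F : C₀(S, ℝ))).measurable
    (F : C₀(S, ℝ)).toBCF.norm_coe_le_norm (map_continuous (Y.generator hY F)).measurable
    (Y.generator hY F).toBCF.norm_coe_le_norm fun ω => (map_continuous _).comp (hYc ω)]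
  simp_rw [← Y.semigroup_apply_eq_integral_transition hY]
  exact sub_eq_zero.2 hintegral.symm

end Feller

end MarkovFamily

section Weak

variable {ι E : Type*} [MeasurableSpace E] [TopologicalSpace E] {l : Filter ι}
  {ρ : ι → ProbabilityMeasure E} {μ ν : ProbabilityMeasure E}

open scoped BoundedContinuousFunction

theorem integral_eq_of_mapClusterPt [OpensMeasurableSpace E] (hμ : MapClusterPt μ l ρ) (G : E →ᵇ ℝ)
    {c : ℝ} (hc : Tendsto (fun i => ∫ w, G w ∂(ρ i : Measure E)) l (𝓝 c)) :
    ∫ w, G w ∂(μ : Measure E) = c := by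
  obtain ⟨U, hU, hUμ⟩ := mapClusterPt_iff_ultrafilter.1 hμ
  exact tendsto_nhds_unique (ProbabilityMeasure.tendsto_iff_forall_integral_tendsto.1 hUμ G)
    (hc.mono_left hU)

theorem tendsto_of_isTightMeasureSet_of_unique_mapClusterPt [T2Space E] [BorelSpace E]
    (htight : IsTightMeasureSet (Set.range fun i => (ρ i : Measure E)))
    (h : ∀ μ, MapClusterPt μ l ρ → μ = ν) : Tendsto ρ l (𝓝 ν) := by
  have hcompact : IsCompact (closure (Set.range ρ)) := isCompact_closure_of_isTightMeasureSet
    (htight.subset (by rintro _ ⟨_, ⟨i, rfl⟩, rfl⟩; exact ⟨i, rfl⟩))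
  exact hcompact.tendsto_nhds_of_unique_mapClusterPt
    (.of_forall fun i => subset_closure ⟨i, rfl⟩) fun μ _ => h μ

end Weak

section WeightedIntegral

theorem norm_integral_mul_le_of_forall_notMem {Ω : Type*} [MeasurableSpace Ω] {P : Measure Ω}
    [IsProbabilityMeasure P] {Φ v : Ω → ℝ} {B C η : ℝ} (hΦ : ∀ ω, ‖Φ ω‖ ≤ B) (hη : 0 ≤ η)
    (hv : ∀ ω, ‖v ω‖ ≤ C) {N : Set Ω} (hN : MeasurableSet N) (hvN : ∀ ω ∉ N, ‖v ω‖ ≤ η) :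
    ‖∫ ω, Φ ω * v ω ∂P‖ ≤ B * (η + P.real N * C) := by
  have hint : Integrable (N.indicator fun _ => C) P := (integrable_const C).indicator hN
  calc ‖∫ ω, Φ ω * v ω ∂P‖ ≤ ∫ ω, B * (η + N.indicator (fun _ => C) ω) ∂P := by
        refine norm_integral_le_of_norm_le (((integrable_const η).add hint).const_mul B)
          (.of_forall fun ω => ?_)
        rw [norm_mul]
        refine mul_le_mul (hΦ ω) ?_ (norm_nonneg _) ((norm_nonneg _).trans (hΦ ω))
        by_cases hω : ω ∈ N
        · rw [Set.indicator_of_mem hω]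
          exact (hv ω).trans (le_add_of_nonneg_left hη)
        · rw [Set.indicator_of_notMem hω, add_zero]
          exact hvN ω hω
    _ = B * (η + P.real N * C) := by
        rw [integral_const_mul, integral_add (integrable_const η) hint,
          integral_indicator_const _ hN]
        simp

theorem tendsto_integral_mul_zero_of_forall_notMem {ι : Type*} {l : Filter ι} {Ω : ι → Type*}
    [∀ i, MeasurableSpace (Ω i)] {P : ∀ i, Measure (Ω i)} [∀ i, IsProbabilityMeasure (P i)]
    {Φ v : ∀ i, Ω i → ℝ} {B C : ℝ} (hB : 0 ≤ B) (hC : 0 ≤ C) (hΦ : ∀ i ω, ‖Φ i ω‖ ≤ B)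
    (hv : ∀ i ω, ‖v i ω‖ ≤ C)
    (hsmall : ∀ η > 0, ∃ N : ∀ i, Set (Ω i), (∀ i, MeasurableSet (N i)) ∧
      (∀ i, (P i).real (N i) ≤ η) ∧ ∀ᶠ i in l, ∀ ω ∉ N i, ‖v i ω‖ ≤ η) :
    Tendsto (fun i => ∫ ω, Φ i ω * v i ω ∂(P i)) l (𝓝 0) := by
  rw [Metric.tendsto_nhds]
  intro δ hδ
  have hlim : Tendsto (fun η : ℝ => B * (η + η * C)) (𝓝[>] 0) (𝓝 0) :=
    (Continuous.tendsto' (by fun_prop) 0 0 (by simp)).mono_left nhdsWithin_le_nhds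
  obtain ⟨η, hηδ, hη⟩ := ((hlim.eventually_lt_const hδ).and self_mem_nhdsWithin).exists
  obtain ⟨N, hN, hPN, hvN⟩ := hsmall η hη
  filter_upwards [hvN] with i hi
  rw [dist_zero_right]
  refine ((norm_integral_mul_le_of_forall_notMem (hΦ i) (le_of_lt hη) (hv i) (hN i) hi).trans
    ?_).trans_lt hηδ
  gcongr
  exact hPN i

end WeightedIntegral

theorem MarkovFamily.measurable_cylinderFunction_comp {M S : Type*} [MeasurableSpace M]
    [TopologicalSpace S] [MeasurableSpace S] [OpensMeasurableSpace S] (X : MarkovFamily M)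
    {h : M → S} (hm : Measurable h) {x : M} (hc : ∀ ω, Continuous fun t => h (X.X x t ω))
    {J : Finset ℝ≥0} {s : ℝ≥0} (hJ : ∀ t ∈ J, t ≤ s) (φ : ℝ≥0 → BoundedContinuousFunction S ℝ) :
    Measurable[processPast (X.X x) s]
      fun ω => cylinderFunction J φ ⟨fun t => h (X.X x t ω), hc ω⟩ := by
  simp_rw [cylinderFunction_apply]
  exact Finset.measurable_prod (m := processPast (X.X x) s) _ fun t ht =>
    (φ t).continuous.measurable.comp (hm.comp (X.measurable_processPast x (hJ t ht)))

section ImageLaw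

variable {M S : Type*} [MeasurableSpace M] [MetricSpace S] [TopologicalSpace.SeparableSpace S]
  [MeasurableSpace S] [BorelSpace S] {h : M → S}

open scoped BoundedContinuousFunction

namespace MarkovFamily

/-- The law on path space of the image under `h` of a Markov family started at `x`. -/
noncomputable def imageLaw (X : MarkovFamily M) (hm : Measurable h) {x : M}
    (hc : ∀ ω, Continuous fun t => h (X.X x t ω)) : ProbabilityMeasure C(ℝ≥0, S) :=
  pathLaw (X.P x) (fun t ω => h (X.X x t ω)) (fun t => hm.comp (X.measurable_X x t)) hc

variable (X : MarkovFamily M) (hm : Measurable h)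

theorem imageLaw_apply {x : M} (hc : ∀ ω, Continuous fun t => h (X.X x t ω)) {B : Set C(ℝ≥0, S)}
    (hB : MeasurableSet B) : (X.imageLaw hm hc : Measure C(ℝ≥0, S)) B =
      X.P x {ω | (⟨fun t => h (X.X x t ω), hc ω⟩ : C(ℝ≥0, S)) ∈ B} :=
  Measure.map_apply (measurable_path _ (fun t => hm.comp (X.measurable_X x t)) hc) hB

theorem integral_imageLaw {x : M} (hc : ∀ ω, Continuous fun t => h (X.X x t ω))
    {G : C(ℝ≥0, S) → ℝ} (hG : Measurable G) :
    ∫ w, G w ∂(X.imageLaw hm hc : Measure C(ℝ≥0, S)) =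
      ∫ ω, G ⟨fun t => h (X.X x t ω), hc ω⟩ ∂(X.P x) :=
  integral_map (measurable_path _ (fun t => hm.comp (X.measurable_X x t)) hc).aemeasurable
    hG.aestronglyMeasurable

theorem integral_eval_zero_imageLaw {x : M} (hc : ∀ ω, Continuous fun t => h (X.X x t ω))
    {f : S → ℝ} (hf : Measurable f) :
    ∫ w, f (w 0) ∂(X.imageLaw hm hc : Measure C(ℝ≥0, S)) = f (h x) := by
  rw [X.integral_imageLaw hm hc (G := fun w => f (w 0))
    (hf.comp (continuous_eval_const 0).measurable)]
  have hstart : ∀ᵐ ω ∂X.P x, f (h (X.X x 0 ω)) = f (h x) :=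
    (X.start x).mono fun ω hω => by rw [hω]
  simpa using integral_congr_ae hstart

theorem integral_cylinderFunction_mul_dynkinIncrement_imageLaw
    (hc : ∀ x ω, Continuous fun t => h (X.X x t ω)) (x : M) {J : Finset ℝ≥0} {s : ℝ≥0}
    (hJ : ∀ t ∈ J, t ≤ s) (φ : ℝ≥0 → S →ᵇ ℝ) (f g : S →ᵇ ℝ) (T : ℝ≥0) :
    ∫ w, cylinderFunction J φ w * dynkinIncrement f g s T w
        ∂(X.imageLaw hm (hc x) : Measure C(ℝ≥0, S)) =
      ∫ ω, cylinderFunction J φ ⟨fun t => h (X.X x t ω), hc x ω⟩ *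
        X.dynkinDefect (f ∘ h) (g ∘ h) T (X.X x s ω) ∂(X.P x) := by
  rw [X.integral_imageLaw hm (hc x)
    (G := fun w => cylinderFunction J φ w * dynkinIncrement f g s T w)
    (cylinderFunction J φ * dynkinIncrement f g s T).continuous.measurable]
  exact X.integral_mul_increment_eq_integral_mul_dynkinDefect (f.continuous.measurable.comp hm)
    (fun z => f.norm_coe_le_norm (h z)) (g.continuous.measurable.comp hm)
    (fun z => g.norm_coe_le_norm (h z)) (fun x ω => g.continuous.comp (hc x ω)) x s T
    (X.measurable_cylinderFunction_comp hm (hc x) hJ φ)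
    fun ω => (cylinderFunction J φ).norm_coe_le_norm _

theorem solvesMartingaleProblem_imageLaw_id {S : Type*} [MetricSpace S]
    [TopologicalSpace.SeparableSpace S] [MeasurableSpace S] [BorelSpace S] (Y : MarkovFamily S)
    (hY : Y.PreservesC0) (hYc : ∀ y ω, Continuous fun t => Y.X y t ω) (y : S) :
    SolvesMartingaleProblem (Y.generator hY)
      (Y.imageLaw measurable_id (hYc y) : Measure C(ℝ≥0, S)) := by
  intro F J φ s T hJ
  rw [Y.integral_cylinderFunction_mul_dynkinIncrement_imageLaw measurable_id hYc y hJ]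
  refine integral_eq_zero_of_ae (.of_forall fun ω => mul_eq_zero_of_right _ ?_)
  exact Y.dynkinDefect_generator hY (hYc _) F T

theorem tendsto_integral_cylinderFunction_mul_dynkinIncrement {ι : Type*} {l : Filter ι}
    (X : ι → MarkovFamily M) (hc : ∀ i x ω, Continuous fun t => h ((X i).X x t ω)) (x : M)
    (htight : IsTightMeasureSet
      (Set.range fun i => ((X i).imageLaw hm (hc i x) : Measure C(ℝ≥0, S))))
    {f g : S →ᵇ ℝ} {T : ℝ≥0} (hdefect : ∀ K : Set S, IsCompact K →
      TendstoUniformlyOn (fun i => (X i).dynkinDefect (f ∘ h) (g ∘ h) T) 0 l (h ⁻¹' K))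
    {J : Finset ℝ≥0} {s : ℝ≥0} (hJ : ∀ t ∈ J, t ≤ s) (φ : ℝ≥0 → S →ᵇ ℝ) :
    Tendsto (fun i => ∫ w, cylinderFunction J φ w * dynkinIncrement f g s T w
      ∂((X i).imageLaw hm (hc i x) : Measure C(ℝ≥0, S))) l (𝓝 0) := by
  simp_rw [(X _).integral_cylinderFunction_mul_dynkinIncrement_imageLaw hm (hc _) x hJ]
  refine tendsto_integral_mul_zero_of_forall_notMem (norm_nonneg (cylinderFunction J φ))
    (by positivity : 0 ≤ ‖f‖ + ‖f‖ + ‖g‖ * T)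
    (fun i ω => (cylinderFunction J φ).norm_coe_le_norm _)
    (fun i ω => (X i).norm_dynkinDefect_le (fun z => f.norm_coe_le_norm (h z))
      (fun z => g.norm_coe_le_norm (h z)) T _) fun η hη => ?_
  obtain ⟨𝒦, h𝒦, hmass⟩ := isTightMeasureSet_iff_exists_isCompact_measure_compl_le.1 htight
    (ENNReal.ofReal η) (ENNReal.ofReal_pos.2 hη)
  let K : Set S := (fun w : C(ℝ≥0, S) => w s) '' 𝒦
  have hK : IsCompact K := h𝒦.image (continuous_eval_const s)
  refine ⟨fun i => {ω | h ((X i).X x s ω) ∉ K}, fun i =>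
    hm.comp ((X i).measurable_X x s) hK.measurableSet.compl, fun i => ?_, ?_⟩
  · refine ENNReal.toReal_le_of_le_ofReal hη.le (le_trans ?_ (hmass _ ⟨i, rfl⟩))
    rw [imageLaw_apply _ _ _ h𝒦.measurableSet.compl]
    exact measure_mono fun ω hω hmem => hω ⟨_, hmem, rfl⟩
  · filter_upwards [Metric.tendstoUniformlyOn_iff.1 (hdefect K hK) η hη] with i hi ω hω
    simpa using (hi _ (not_not.1 hω)).le

theorem solvesMartingaleProblem_of_mapClusterPt {ι : Type*} {l : Filter ι}
    (X : ι → MarkovFamily M) (hc : ∀ i x ω, Continuous fun t => h ((X i).X x t ω)) (x : M)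
    (htight : IsTightMeasureSet
      (Set.range fun i => ((X i).imageLaw hm (hc i x) : Measure C(ℝ≥0, S))))
    {A : C₀(S, ℝ) →ₗ.[ℝ] C₀(S, ℝ)} (hdefect : ∀ (F : A.domain) (T : ℝ≥0), 0 < T →
      ∀ K : Set S, IsCompact K → TendstoUniformlyOn
        (fun i => (X i).dynkinDefect ((F : C₀(S, ℝ)) ∘ h) (A F ∘ h) T) 0 l (h ⁻¹' K))
    {μ : ProbabilityMeasure C(ℝ≥0, S)}
    (hμ : MapClusterPt μ l fun i => (X i).imageLaw hm (hc i x)) :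
    SolvesMartingaleProblem A (μ : Measure C(ℝ≥0, S)) := by
  intro F J φ s T hJ
  obtain rfl | hT := eq_zero_or_pos T
  · simp [dynkinIncrement_apply]
  · exact integral_eq_of_mapClusterPt hμ (cylinderFunction J φ *
      dynkinIncrement (F : C₀(S, ℝ)).toBCF (A F).toBCF s T)
      (tendsto_integral_cylinderFunction_mul_dynkinIncrement hm X hc x htight (hdefect F T hT)
        hJ φ)

end MarkovFamily

end ImageLaw

theorem mainTheorem3_general {ι M S : Type*} {𝓕 : Filter ι} [MeasurableSpace M] [MetricSpace S]
    [LocallyCompactSpace S] [TopologicalSpace.SeparableSpace S] [MeasurableSpace S] [BorelSpace S]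
    {h : M → S} (hh : Measurable h) (X : ι → MarkovFamily M)
    (hXc : ∀ i x ω, Continuous fun t => h ((X i).X x t ω))
    (Y : MarkovFamily S) (hYc : ∀ y ω, Continuous fun t => Y.X y t ω) (hY : Y.PreservesC0)
    {A : C₀(S, ℝ) →ₗ.[ℝ] C₀(S, ℝ)} (hA : A ≤ Y.generator hY) {l : ℝ} (hl : 0 < l)
    (hdense : DenseRange fun F : A.domain => l • (F : C₀(S, ℝ)) - A F)
    (hdefect : ∀ (F : A.domain) (T : ℝ≥0), 0 < T → ∀ K : Set S, IsCompact K →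
      TendstoUniformlyOn (fun i => (X i).dynkinDefect ((F : C₀(S, ℝ)) ∘ h) (A F ∘ h) T) 0 𝓕
        (h ⁻¹' K))
    (x : M) (htight : IsTightMeasureSet
      (Set.range fun i => ((X i).imageLaw hh (hXc i x) : Measure C(ℝ≥0, S)))) :
    Tendsto (fun i => (X i).imageLaw hh (hXc i x)) 𝓕
      (𝓝 (Y.imageLaw measurable_id (hYc (h x)))) := by
  refine tendsto_of_isTightMeasureSet_of_unique_mapClusterPt htight fun μ hμ =>
    ProbabilityMeasure.toMeasure_injective ?_
  have hμ_solves : SolvesMartingaleProblem A (μ : Measure C(ℝ≥0, S)) :=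
    MarkovFamily.solvesMartingaleProblem_of_mapClusterPt hh X hXc x htight hdefect hμ
  have hμ_init (f : C₀(S, ℝ)) : ∫ w, f (w 0) ∂(μ : Measure C(ℝ≥0, S)) = f (h x) :=
    integral_eq_of_mapClusterPt hμ (f.toBCF.compContinuous ⟨fun w => w 0, continuous_eval_const 0⟩)
      (tendsto_const_nhds.congr fun i => ((X i).integral_eval_zero_imageLaw hh (hXc i x)
        (map_continuous f).measurable).symm)
  have hdiss : IsDissipative A :=
    (isDissipative_infinitesimalGenerator (Y.norm_semigroup_le hY)).mono hA
  have hY_solves := (Y.solvesMartingaleProblem_imageLaw_id hY hYc (h x)).mono hA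
  exact hμ_solves.eq hdiss hl hdense hY_solves fun f => (hμ_init f).trans
    (Y.integral_eval_zero_imageLaw measurable_id (hYc (h x)) (map_continuous f).measurable).symm

theorem mainTheorem3
    {M S : Type*} [MetricSpace M] [MeasurableSpace M] [BorelSpace M]
    [MetricSpace S] [LocallyCompactSpace S] [TopologicalSpace.SeparableSpace S]
    [MeasurableSpace S] [BorelSpace S]
    (h : M → S) (hh : Continuous h)
    (X : Set.Ioi (0 : ℝ) → MarkovFamily M)
    (hXc : ∀ ε x ω, Continuous fun t => h ((X ε).X x t ω))
    (Y : MarkovFamily S)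
    (hYc : ∀ y ω, Continuous fun t => Y.X y t ω)
    (hY : Y.PreservesC0)
    (Ψ : Submodule ℝ C₀(S, ℝ)) (hΨ : Dense (Ψ : Set C₀(S, ℝ)))
    (D : Submodule ℝ C₀(S, ℝ)) (hD : D ≤ (Y.generator hY).domain)
    (h1 : ∃ l : ℝ, 0 < l ∧ ∀ f ∈ Ψ, ∃ F : (Y.generator hY).domain, (F : C₀(S, ℝ)) ∈ D ∧
      l • (F : C₀(S, ℝ)) - Y.generator hY F = f)
    (h2 : ∀ T : ℝ≥0, 0 < T → ∀ f : (Y.generator hY).domain, (f : C₀(S, ℝ)) ∈ D →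
      ∀ K : Set S, IsCompact K →
        TendstoUniformlyOn
          (fun (ε : Set.Ioi (0 : ℝ)) (x : M) =>
            ∫ ω, ((f : C₀(S, ℝ)) (h ((X ε).X x T ω)) - (f : C₀(S, ℝ)) (h ((X ε).X x 0 ω))
              - ∫ t in (0 : ℝ)..T, Y.generator hY f (h ((X ε).X x t.toNNReal ω))) ∂((X ε).P x))
          (fun _ => 0) (comap (fun ε : Set.Ioi (0 : ℝ) => (ε : ℝ)) (𝓝[>] 0)) (h ⁻¹' K))
    (htight : ∀ x : M, IsTightMeasureSet (Set.range fun ε : Set.Ioi (0 : ℝ) =>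
      (pathLaw ((X ε).P x) (fun t ω => h ((X ε).X x t ω))
        (fun t => hh.measurable.comp ((X ε).measurable_X x t)) (hXc ε x) :
          Measure C(ℝ≥0, S))))
    (x : M) :
    Tendsto
      (fun ε : Set.Ioi (0 : ℝ) => pathLaw ((X ε).P x) (fun t ω => h ((X ε).X x t ω))
        (fun t => hh.measurable.comp ((X ε).measurable_X x t)) (hXc ε x))
      (comap (fun ε : Set.Ioi (0 : ℝ) => (ε : ℝ)) (𝓝[>] 0))
      (𝓝 (pathLaw (Y.P (h x)) (Y.X (h x)) (Y.measurable_X (h x)) (hYc (h x)))) := by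
  obtain ⟨l, hl, hsolve⟩ := h1
  refine mainTheorem3_general hh.measurable X hXc Y hYc hY (A := (Y.generator hY).domRestrict D)
    LinearPMap.domRestrict_le hl (hΨ.mono fun f hf => ?_)
    (fun F T hT K hK => h2 T hT ⟨F, F.2.2⟩ F.2.1 K hK) x (htight x)
  obtain ⟨F, hFD, hF⟩ := hsolve f hf
  exact ⟨⟨F, hFD, F.2⟩, hF⟩
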